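/- Let $N\ge 3$. For $u\in C_c^2(\mathbb{R}^N)$ (real-valued) put $$\|u\|_{2-\frac2N,N}:=\|u\|_{W^{1,N}(\mathbb{R}^N)}+\left(\int_{\mathbb{R}^N}\int_{\mathbb{R}^N}\frac{|Du(x)-Du(y)|^N}{|x-y|^{N+\sigma N}}\,dx\,dy\right)^{1/N},\qquad \sigma=1-\frac2N,$$ where $\|u\|_{W^{1,N}}=\|u\|_{L^N}+\|Du\|_{L^N}$. Then there is a constant $C>0$, depending only on $N$, such that for all $u_1,u_2,\varphi\in C_c^2(\mathbb{R}^N)$ $$\left|\int_{\mathbb{R}^N}\big(\det(D^2u_1)-\det(D^2u_2)\big)\varphi\,dx\right|\le C\,\|u_1-u_2\|_{2-\frac2N,N}\left(\|u_1\|_{2-\frac2N,N}^{N-1}+\|u_2\|_{2-\frac2N,N}^{N-1}\right)\|D^2\varphi\|_{L^\infty(\mathbb{R}^N)}.$$ -/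

import Mathlib

open MeasureTheory
open scoped ENNReal

/-- The Hessian matrix `D²u(x)`, with `(i, j)` entry `∂ᵢ∂ⱼu(x)`. -/
noncomputable def hessianMatrix {N : ℕ} (u : EuclideanSpace ℝ (Fin N) → ℝ)
    (x : EuclideanSpace ℝ (Fin N)) : Matrix (Fin N) (Fin N) ℝ :=
  Matrix.of fun i j =>
    fderiv ℝ (fderiv ℝ u) x (EuclideanSpace.single i 1) (EuclideanSpace.single j 1)

/-- The `W^{1,p}` norm `‖u‖_{L^p} + ‖Du‖_{L^p}` of a `C¹` function (possibly infinite).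
The operator norm of `fderiv ℝ u x` is the Euclidean length of the gradient. -/
noncomputable def sobolevENorm {N : ℕ} (p : ℝ) (u : EuclideanSpace ℝ (Fin N) → ℝ) : ℝ≥0∞ :=
  eLpNorm u (ENNReal.ofReal p) volume + eLpNorm (fderiv ℝ u) (ENNReal.ofReal p) volume

/-- The Gagliardo seminorm of order `σ` and exponent `p` of the derivative `Du`
(possibly infinite). -/
noncomputable def gagliardoESeminormDeriv {N : ℕ} (σ p : ℝ)
    (u : EuclideanSpace ℝ (Fin N) → ℝ) : ℝ≥0∞ :=
  (∫⁻ x : EuclideanSpace ℝ (Fin N), ∫⁻ y : EuclideanSpace ℝ (Fin N),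
    ENNReal.ofReal (‖fderiv ℝ u x - fderiv ℝ u y‖ ^ p / ‖x - y‖ ^ ((N : ℝ) + σ * p))) ^ (1 / p)

/-- The norm of `B(s,p)`, `1 < s < 2`, `1 ≤ p < ∞`, on `C¹` functions (possibly infinite):
the `W^{1,p}` norm plus the Gagliardo seminorm of `Du` of order `σ = s - 1`. -/
noncomputable def besovENorm {N : ℕ} (s p : ℝ) (u : EuclideanSpace ℝ (Fin N) → ℝ) : ℝ≥0∞ :=
  sobolevENorm p u + gagliardoESeminormDeriv (s - 1) p u

/-- The `B(s,p)` norm as a real number, for functions of finite norm. -/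
noncomputable def besovNorm {N : ℕ} (s p : ℝ) (u : EuclideanSpace ℝ (Fin N) → ℝ) : ℝ :=
  (besovENorm s p u).toReal

/-- `‖D²φ‖_{L^∞}`, with `D²φ(x)` measured by its norm as a bilinear form. -/
noncomputable def hessianSupNorm {N : ℕ} (φ : EuclideanSpace ℝ (Fin N) → ℝ) : ℝ :=
  (eLpNorm (fderiv ℝ (fderiv ℝ φ)) ∞ volume).toReal

/-! Extend `u` to the half space of pairs `(t, x)` with `t > 0` by `moll u t`, its mollification at
scale `t`, and follow `∫ det(D² u_t) φ` as `t` runs over `(0, ∞)`. As `t → 0` the integral tends to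
`∫ det(D²u) φ`. As `t → ∞` it tends to `0`, because `D² u_t = O(1/t)`. The quantity to be bounded is
therefore the total variation in scale, that is, an integral of `t`-derivatives.

The `t`-derivative of `det(D² u_t)` is the cofactor matrix of `D² u_t` contracted with `D² ∂ₜu_t`.
Rows of the cofactor matrix of a Hessian are divergence free
(`sum_dirDeriv_hessianCofactor_eq_zero`), so two integrations by parts move both derivatives from
`∂ₜu_t` to `φ` (`integral_sum_det_updateRow_hessian`). What remains is `mollFlux`: `∂ₜu_t` times
cofactors of `D² u_t` times `D²φ`.

Let `osc` denote the mean oscillation of `Du` on the ball of radius `t` around `x`. Since the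
mollifier is even, `|∂ₜu_t| ≤ K osc`; since its derivatives have mean zero, `|D² u_t| ≤ K osc / t`.
The flux is thus of size `t^(1-N) osc^N |D²φ|`. By multilinearity the difference of two fluxes
contains one factor `osc` of `u₁ - u₂` and `N - 1` factors of `u₁`, `u₂` (`abs_mollFlux_sub_le`).

Hölder with exponent `N` for the measure `t^(1-N) dt dx` separates the factors. Jensen and Tonelli
then give `∫∫ osc^N t^(1-N) dt dx ≤ c ∫∫ |Du(x) - Du(y)|^N ∫_{|x-y|}^∞ t^(1-2N) dt`. The inner
integral is a multiple of `|x-y|^(-(2N-2))`, which is exactly the Gagliardo kernel because `N + σN =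
2N - 2` (`lintegral_gradEOsc_pow_le`). -/

/-! ### Determinants as multilinear functions of their rows. -/

/-- The determinant is bounded by `n!` times the product of the sup norms of the rows. -/
theorem norm_det_le_factorial_mul_prod_norm {n : ℕ} (m : Fin n → Fin n → ℝ) :
    ‖(Matrix.detRowAlternating (R := ℝ) (n := Fin n)).toMultilinearMap m‖ ≤
      (n.factorial : ℝ) * ∏ i, ‖m i‖ := by
  have h : (Matrix.detRowAlternating (R := ℝ) (n := Fin n)).toMultilinearMap m =
      ∑ σ : Equiv.Perm (Fin n), Equiv.Perm.sign σ • ∏ i, m i (σ i) := by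
    change Matrix.det (Matrix.of m) = _
    rw [← Matrix.det_transpose, Matrix.det_apply]
    rfl
  rw [h]
  refine (norm_sum_le _ _).trans ?_
  have h2 : ∀ σ ∈ (Finset.univ : Finset (Equiv.Perm (Fin n))),
      ‖Equiv.Perm.sign σ • ∏ i, m i (σ i)‖ ≤ ∏ i, ‖m i‖ := by
    intro σ _
    have : ‖Equiv.Perm.sign σ • ∏ i, m i (σ i)‖ = ‖∏ i, m i (σ i)‖ := by
      rcases Int.units_eq_one_or (Equiv.Perm.sign σ) with h | h <;> simp [h]
    rw [this, norm_prod]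
    exact Finset.prod_le_prod (fun _ _ => norm_nonneg _) fun i _ => norm_le_pi_norm (m i) _
  refine (Finset.sum_le_card_nsmul _ _ _ h2).trans ?_
  simp [Fintype.card_perm]

/-- The determinant as a continuous multilinear map in the rows. -/
noncomputable def detRowCMM (n : ℕ) :
    ContinuousMultilinearMap ℝ (fun _ : Fin n => Fin n → ℝ) ℝ :=
  (Matrix.detRowAlternating (R := ℝ) (n := Fin n)).toMultilinearMap.mkContinuous
    n.factorial norm_det_le_factorial_mul_prod_norm

theorem abs_det_le {n : ℕ} {A : Matrix (Fin n) (Fin n) ℝ} {M : ℝ} (hM : 0 ≤ M)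
    (hA : ∀ i j, |A i j| ≤ M) : |A.det| ≤ n.factorial * M ^ n := by
  refine (norm_det_le_factorial_mul_prod_norm (fun i j => A i j)).trans ?_
  gcongr
  calc ∏ i, ‖fun j => A i j‖ ≤ ∏ _i : Fin n, M :=
        Finset.prod_le_prod (fun _ _ => norm_nonneg _) fun i _ =>
          (pi_norm_le_iff_of_nonneg hM).2 fun j => hA i j
    _ = M ^ n := by simp

theorem abs_det_sub_det_le {n : ℕ} {A B : Matrix (Fin n) (Fin n) ℝ} {M δ : ℝ} (hM : 0 ≤ M)
    (hδ : 0 ≤ δ) (hA : ∀ i j, |A i j| ≤ M) (hB : ∀ i j, |B i j| ≤ M)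
    (hAB : ∀ i j, |A i j - B i j| ≤ δ) :
    |A.det - B.det| ≤ n.factorial * n * M ^ (n - 1) * δ := by
  have h := (Matrix.detRowAlternating (R := ℝ) (n := Fin n)).toMultilinearMap
    |>.norm_image_sub_le_of_bound (Nat.cast_nonneg _) norm_det_le_factorial_mul_prod_norm
      (fun i j => A i j) (fun i j => B i j)
  rw [Fintype.card_fin] at h
  refine h.trans ?_
  have hn : ∀ {D : Fin n → Fin n → ℝ} {K : ℝ}, 0 ≤ K → (∀ i j, |D i j| ≤ K) → ‖D‖ ≤ K :=
    fun hK hD => (pi_norm_le_iff_of_nonneg hK).2 fun i =>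
      (pi_norm_le_iff_of_nonneg hK).2 fun j => hD i j
  gcongr
  · exact max_le (hn hM hA) (hn hM hB)
  · exact hn hδ hAB

/-- Derivative of the determinant of a matrix-valued map, row by row. -/
theorem HasFDerivAt.matrix_det {n : ℕ} {E : Type*} [NormedAddCommGroup E] [NormedSpace ℝ E]
    {A : E → Matrix (Fin n) (Fin n) ℝ} {A' : Fin n → Fin n → E →L[ℝ] ℝ} {x : E}
    (hA : ∀ i j, HasFDerivAt (fun y => A y i j) (A' i j) x) :
    ∃ D : E →L[ℝ] ℝ, HasFDerivAt (fun y => (A y).det) D x ∧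
      ∀ v, D v = ∑ i, ((A x).updateRow i fun j => A' i j v).det := by
  have h1 : HasFDerivAt (fun y => (fun i j => A y i j : Fin n → Fin n → ℝ))
      (ContinuousLinearMap.pi fun i => ContinuousLinearMap.pi fun j => A' i j) x := by
    rw [hasFDerivAt_pi]
    intro i
    rw [hasFDerivAt_pi]
    exact fun j => hA i j
  have h2 := HasFDerivAt.comp (g := detRowCMM n) (f := fun y => (fun i j => A y i j)) x
    ((detRowCMM n).hasFDerivAt (x := fun i j => A x i j)) h1
  refine ⟨_, h2, fun v => ?_⟩
  simp only [ContinuousLinearMap.comp_apply, ContinuousMultilinearMap.linearDeriv_apply]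
  rfl

theorem ContDiffOn.matrix_det {n : ℕ} {E : Type*} [NormedAddCommGroup E] [NormedSpace ℝ E]
    {A : E → Matrix (Fin n) (Fin n) ℝ} {k : WithTop ℕ∞} {s : Set E}
    (hA : ∀ i j, ContDiffOn ℝ k (fun y => A y i j) s) : ContDiffOn ℝ k (fun y => (A y).det) s :=
  (detRowCMM n).contDiff.comp_contDiffOn
    (contDiffOn_pi.2 fun i => contDiffOn_pi.2 fun j => hA i j)

theorem det_updateRow_eq_sum {n : ℕ} (A : Matrix (Fin n) (Fin n) ℝ) (i : Fin n)
    (b : Fin n → ℝ) :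
    (A.updateRow i b).det = ∑ j, b j * (A.updateRow i (Pi.single j 1)).det := by
  have h : b = ∑ j, b j • (Pi.single j 1 : Fin n → ℝ) := by
    ext k; simp [Finset.sum_apply, Pi.single_apply]
  conv_lhs => rw [h]
  have h2 := (Matrix.detRowAlternating (R := ℝ) (n := Fin n)).toMultilinearMap.map_update_sum
    Finset.univ i (fun j => b j • (Pi.single j 1 : Fin n → ℝ)) A
  refine h2.trans (Finset.sum_congr rfl fun j _ => ?_)
  exact Matrix.det_updateRow_smul A i (b j) _

/-- Cancellation behind the Piola identity. -/
theorem sum_det_updateRow_updateRow_eq_zero {n : ℕ} (A : Matrix (Fin n) (Fin n) ℝ) {i l : Fin n}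
    (hil : l ≠ i) (T : Fin n → Fin n → ℝ) (hT : ∀ j m, T j m = T m j) :
    ∑ j, ((A.updateRow i (Pi.single j 1)).updateRow l (T j)).det = 0 := by
  -- Exchanging the two unit rows swaps rows `i` and `l`, so the double-row determinant is
  -- antisymmetric in `(j, m)`.
  have anti : ∀ j m, ((A.updateRow i (Pi.single j 1)).updateRow l (Pi.single m 1)).det =
      - ((A.updateRow i (Pi.single m 1)).updateRow l (Pi.single j 1)).det := by
    intro j m
    have h := Matrix.detRowAlternating.map_swap (R := ℝ)
      ((A.updateRow i (Pi.single m 1)).updateRow l (Pi.single j 1)) hil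
    have e : ((A.updateRow i (Pi.single j 1)).updateRow l (Pi.single m 1)) =
        ((A.updateRow i (Pi.single m 1)).updateRow l (Pi.single j 1)) ∘ Equiv.swap l i := by
      ext k q
      change _ = ((A.updateRow i (Pi.single m 1)).updateRow l (Pi.single j 1)) (Equiv.swap l i k) q
      by_cases hk : k = i
      · subst hk; simp [Matrix.updateRow_apply, hil.symm]
      · by_cases hk' : k = l
        · subst hk'; simp [Matrix.updateRow_apply, hil.symm]
        · simp [Matrix.updateRow_apply, hk, hk', Equiv.swap_apply_of_ne_of_ne hk' hk]
    rw [e]; exact h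
  have key : ∑ j, ((A.updateRow i (Pi.single j 1)).updateRow l (T j)).det =
      ∑ j, ∑ m, T j m * ((A.updateRow i (Pi.single j 1)).updateRow l (Pi.single m 1)).det :=
    Finset.sum_congr rfl fun j _ => det_updateRow_eq_sum _ _ _
  -- A symmetric array contracted with an antisymmetric one equals its own negative.
  have key2 : ∑ j, ∑ m, T j m *
        ((A.updateRow i (Pi.single j 1)).updateRow l (Pi.single m 1)).det =
      - ∑ j, ∑ m, T j m *
        ((A.updateRow i (Pi.single j 1)).updateRow l (Pi.single m 1)).det := by
    conv_lhs => rw [Finset.sum_comm]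
    rw [← Finset.sum_neg_distrib]
    refine Finset.sum_congr rfl fun j _ => ?_
    rw [← Finset.sum_neg_distrib]
    refine Finset.sum_congr rfl fun m _ => ?_
    rw [anti m j, hT m j]; ring
  rw [key]; linarith

/-! ### Directional derivatives and integration by parts. -/

section DirectionalDerivative

variable {E : Type*} [NormedAddCommGroup E] [NormedSpace ℝ E]

/-- The derivative of `f` in the direction `v`, as a function. -/
noncomputable def dirDeriv (v : E) (f : E → ℝ) : E → ℝ := fun x => fderiv ℝ f x v

theorem ContDiff.dirDeriv {f : E → ℝ} {m n : WithTop ℕ∞} (hf : ContDiff ℝ n f) (hmn : m + 1 ≤ n)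
    (v : E) : ContDiff ℝ m (dirDeriv v f) :=
  (hf.fderiv_right hmn).clm_apply contDiff_const

theorem ContDiffOn.dirDeriv {f : E → ℝ} {m n : WithTop ℕ∞} {s : Set E} (hf : ContDiffOn ℝ n f s)
    (hs : IsOpen s) (hmn : m + 1 ≤ n) (v : E) : ContDiffOn ℝ m (dirDeriv v f) s :=
  (hf.fderiv_of_isOpen hs hmn).clm_apply contDiffOn_const

theorem HasCompactSupport.dirDeriv {f : E → ℝ} (hf : HasCompactSupport f) (v : E) :
    HasCompactSupport (dirDeriv v f) := by
  refine (hf.fderiv ℝ).mono' ?_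
  refine Set.Subset.trans ?_ subset_closure
  intro x hx h
  exact hx (by simp [_root_.dirDeriv, h])

theorem dirDeriv_dirDeriv {f : E → ℝ} {x : E} (hf : ContDiffAt ℝ 2 f x) (v w : E) :
    dirDeriv v (dirDeriv w f) x = fderiv ℝ (fderiv ℝ f) x v w := by
  have h : DifferentiableAt ℝ (fderiv ℝ f) x :=
    (hf.fderiv_right (m := 1) (by norm_num)).differentiableAt (by norm_num)
  change fderiv ℝ (fun y => fderiv ℝ f y w) x v = _
  rw [fderiv_clm_apply h (differentiableAt_const w)]
  simp

theorem dirDeriv_mul {f g : E → ℝ} {x : E} (hf : DifferentiableAt ℝ f x)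
    (hg : DifferentiableAt ℝ g x) (v : E) :
    dirDeriv v (fun y => f y * g y) x = f x * dirDeriv v g x + dirDeriv v f x * g x := by
  simp only [dirDeriv]
  rw [fderiv_fun_mul hf hg]
  simp; ring

theorem dirDeriv_comm {f : E → ℝ} {x : E} (hf : ContDiffAt ℝ 2 f x) (v w : E) :
    dirDeriv v (dirDeriv w f) x = dirDeriv w (dirDeriv v f) x := by
  rw [dirDeriv_dirDeriv hf, dirDeriv_dirDeriv hf]
  exact (hf.isSymmSndFDerivAt (by simp)) v w

theorem integral_mul_dirDeriv_eq_neg [MeasurableSpace E] [BorelSpace E] [FiniteDimensional ℝ E]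
    {μ : Measure E} [μ.IsAddHaarMeasure] {f g : E → ℝ} (hf : ContDiff ℝ 1 f)
    (hg : ContDiff ℝ 1 g) (hcg : HasCompactSupport g) (v : E) :
    ∫ x, f x * dirDeriv v g x ∂μ = - ∫ x, dirDeriv v f x * g x ∂μ := by
  have hf' : Continuous (dirDeriv v f) := (hf.dirDeriv (m := 0) (by simp) v).continuous
  have hg' : Continuous (dirDeriv v g) := (hg.dirDeriv (m := 0) (by simp) v).continuous
  refine integral_mul_fderiv_eq_neg_fderiv_mul_of_integrable ?_ ?_ ?_
    (fun x _ => hf.differentiable (by simp) x) (fun x _ => hg.differentiable (by simp) x)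
  · exact (hf'.mul hg.continuous).integrable_of_hasCompactSupport hcg.mul_left
  · exact (hf.continuous.mul hg').integrable_of_hasCompactSupport (hcg.dirDeriv v).mul_left
  · exact (hf.continuous.mul hg.continuous).integrable_of_hasCompactSupport hcg.mul_left

end DirectionalDerivative

/-! ### Cofactors of the Hessian and the double integration by parts. -/

section Hessian

variable {N : ℕ}

/-- The standard basis vectors of `ℝᴺ`. -/
noncomputable abbrev stdVec (i : Fin N) : EuclideanSpace ℝ (Fin N) := EuclideanSpace.single i 1

theorem hessianMatrix_eq_dirDeriv {u : EuclideanSpace ℝ (Fin N) → ℝ}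
    {x : EuclideanSpace ℝ (Fin N)} (hu : ContDiffAt ℝ 2 u x) (i j : Fin N) :
    hessianMatrix u x i j = dirDeriv (stdVec i) (dirDeriv (stdVec j) u) x :=
  (dirDeriv_dirDeriv hu _ _).symm

theorem hessianMatrix_symm {u : EuclideanSpace ℝ (Fin N) → ℝ}
    {x : EuclideanSpace ℝ (Fin N)} (hu : ContDiffAt ℝ 2 u x) (i j : Fin N) :
    hessianMatrix u x i j = hessianMatrix u x j i :=
  (hu.isSymmSndFDerivAt (by simp)) _ _

/-- The cofactors of the Hessian matrix. -/
noncomputable def hessianCofactor (a : EuclideanSpace ℝ (Fin N) → ℝ) (i j : Fin N)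
    (x : EuclideanSpace ℝ (Fin N)) : ℝ :=
  ((hessianMatrix a x).updateRow i (Pi.single j 1)).det

/-- The adjugate commutes with transposition and the Hessian is symmetric. This makes the cofactor
matrix divergence free in its first index as well as its second. -/
theorem hessianCofactor_symm {a : EuclideanSpace ℝ (Fin N) → ℝ}
    {x : EuclideanSpace ℝ (Fin N)} (ha : ContDiffAt ℝ 2 a x) (i j : Fin N) :
    hessianCofactor a i j x = hessianCofactor a j i x := by
  have hs : (hessianMatrix a x).transpose = hessianMatrix a x := by
    ext k l; exact hessianMatrix_symm ha l k
  have h := Matrix.adjugate_transpose (hessianMatrix a x)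
  rw [hs] at h
  have h2 := congrFun (congrFun h j) i
  simpa [Matrix.adjugate_apply, hessianCofactor] using h2.symm

theorem contDiff_hessianMatrix {a : EuclideanSpace ℝ (Fin N) → ℝ} {m n : WithTop ℕ∞}
    (ha : ContDiff ℝ n a) (hmn : m + 2 ≤ n) (k l : Fin N) :
    ContDiff ℝ m (fun x => hessianMatrix a x k l) := by
  have h1 : m + 1 + 1 ≤ n := by rwa [add_assoc, one_add_one_eq_two]
  have h2 : ContDiff ℝ 2 a := ha.of_le (le_trans (by simp) hmn)
  have h3 := ((ha.dirDeriv h1 (stdVec l)).dirDeriv le_rfl (stdVec k))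
  have h4 : (fun x => hessianMatrix a x k l) = dirDeriv (stdVec k) (dirDeriv (stdVec l) a) :=
    funext fun x => hessianMatrix_eq_dirDeriv h2.contDiffAt k l
  rwa [h4]

theorem contDiff_hessianCofactor {a : EuclideanSpace ℝ (Fin N) → ℝ} {m n : WithTop ℕ∞}
    (ha : ContDiff ℝ n a) (hmn : m + 2 ≤ n) (i j : Fin N) :
    ContDiff ℝ m (hessianCofactor a i j) := by
  rw [← contDiffOn_univ]
  refine ContDiffOn.matrix_det fun k l => contDiffOn_univ.2 ?_
  by_cases h : k = i
  · subst h
    simpa using contDiff_const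
  · simpa [Matrix.updateRow_apply, h] using contDiff_hessianMatrix ha hmn k l

/-- The Piola identity: the cofactor matrix of a Hessian is divergence free. -/
theorem sum_dirDeriv_hessianCofactor_eq_zero {a : EuclideanSpace ℝ (Fin N) → ℝ}
    (ha : ContDiff ℝ 3 a) (i : Fin N) (x : EuclideanSpace ℝ (Fin N)) :
    ∑ j, dirDeriv (stdVec j) (hessianCofactor a i j) x = 0 := by
  have ha2 : ContDiff ℝ 2 a := ha.of_le (by norm_num)
  -- Third derivatives of `a`: entry `(l, m)` of the Hessian differentiated in direction `j`, hence
  -- symmetric in `j` and `m`.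
  set T : Fin N → Fin N → Fin N → ℝ := fun l j m =>
    fderiv ℝ (fun y => hessianMatrix a y l m) x (stdVec j) with hT
  have hTs : ∀ l j m, T l j m = T l m j := by
    intro l j m
    have e : ∀ m, (fun y => hessianMatrix a y l m) =
        dirDeriv (stdVec m) (dirDeriv (stdVec l) a) := by
      intro m
      ext y
      rw [hessianMatrix_symm ha2.contDiffAt, hessianMatrix_eq_dirDeriv ha2.contDiffAt]
    simp only [hT, e]
    exact dirDeriv_comm (ha.dirDeriv (m := 2) (by norm_num) _).contDiffAt _ _
  have key : ∀ j, dirDeriv (stdVec j) (hessianCofactor a i j) x =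
      ∑ l ∈ Finset.univ.erase i,
        (((hessianMatrix a x).updateRow i (Pi.single j 1)).updateRow l (T l j)).det := by
    intro j
    have hA : ∀ k l, HasFDerivAt
        (fun y => ((hessianMatrix a y).updateRow i (Pi.single j 1)) k l)
        (if k = i then 0 else fderiv ℝ (fun y => hessianMatrix a y k l) x) x := by
      intro k l
      by_cases h : k = i
      · subst h
        simpa using hasFDerivAt_const _ _
      · simpa [Matrix.updateRow_apply, h] using
          ((contDiff_hessianMatrix ha (m := 1) (by norm_num) k l).differentiable
            (by norm_num) x).hasFDerivAt
    obtain ⟨D, hD, hDv⟩ := HasFDerivAt.matrix_det hA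
    have : dirDeriv (stdVec j) (hessianCofactor a i j) x = D (stdVec j) := by
      rw [dirDeriv, HasFDerivAt.fderiv (f := hessianCofactor a i j) hD]
    rw [this, hDv, ← Finset.sum_erase_add _ _ (Finset.mem_univ i)]
    -- Row `i` is a constant unit vector, so differentiating that row contributes a determinant with
    -- a zero row.
    have h0 : (((hessianMatrix a x).updateRow i (Pi.single j 1)).updateRow i fun l =>
        (if i = i then (0 : EuclideanSpace ℝ (Fin N) →L[ℝ] ℝ)
          else fderiv ℝ (fun y => hessianMatrix a y i l) x) (stdVec j)).det = 0 :=
      Matrix.det_eq_zero_of_row_eq_zero i fun l => by simp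
    rw [h0, add_zero]
    refine Finset.sum_congr rfl fun l hl => ?_
    simp only [(Finset.mem_erase.1 hl).1, if_false, hT]
  rw [Finset.sum_congr rfl fun j _ => key j, Finset.sum_comm]
  refine Finset.sum_eq_zero fun l hl => ?_
  exact sum_det_updateRow_updateRow_eq_zero _ (Finset.mem_erase.1 hl).1 (T l) (hTs l)

/-- Double integration by parts for the linearized Hessian determinant. -/
theorem integral_sum_det_updateRow_hessian {a v φ : EuclideanSpace ℝ (Fin N) → ℝ}
    (ha : ContDiff ℝ 3 a) (hv : ContDiff ℝ 2 v) (hφ : ContDiff ℝ 2 φ)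
    (hcφ : HasCompactSupport φ) :
    ∫ x, (∑ i, ((hessianMatrix a x).updateRow i fun j => hessianMatrix v x i j).det) * φ x =
      ∫ x, v x * ∑ i, ∑ j, hessianCofactor a i j x * hessianMatrix φ x i j := by
  have ha2 : ContDiff ℝ 2 a := ha.of_le (by norm_num)
  have hc : ∀ i j, ContDiff ℝ 1 (hessianCofactor a i j) := fun i j =>
    contDiff_hessianCofactor ha (by norm_num) i j
  have hv1 : ∀ i, ContDiff ℝ 1 (dirDeriv (stdVec i) v) := fun i => hv.dirDeriv (by norm_num) _
  have hφ1 : ∀ i, ContDiff ℝ 1 (dirDeriv (stdVec i) φ) := fun i => hφ.dirDeriv (by norm_num) _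
  have hφ' : ContDiff ℝ 1 φ := hφ.of_le (by norm_num)
  have hv' : ContDiff ℝ 1 v := hv.of_le (by norm_num)
  have cd : ∀ {f : EuclideanSpace ℝ (Fin N) → ℝ} (i : Fin N), ContDiff ℝ 1 f →
      Continuous (dirDeriv (stdVec i) f) := fun i hf =>
    (hf.dirDeriv (m := 0) (by simp) _).continuous
  have int : ∀ {f g : EuclideanSpace ℝ (Fin N) → ℝ}, Continuous f → Continuous g →
      HasCompactSupport g → Integrable (fun x => f x * g x) := fun hf hg hcg =>
    (hf.mul hg).integrable_of_hasCompactSupport hcg.mul_left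
  -- first integration by parts
  have s1 : ∀ i, ∫ x, (∑ j, hessianCofactor a i j x *
        dirDeriv (stdVec j) (dirDeriv (stdVec i) v) x) * φ x =
      - ∫ x, dirDeriv (stdVec i) v x * ∑ j, hessianCofactor a i j x *
        dirDeriv (stdVec j) φ x := by
    intro i
    have e : ∀ j, ∫ x, dirDeriv (stdVec i) v x * (hessianCofactor a i j x *
          dirDeriv (stdVec j) φ x) + dirDeriv (stdVec i) v x *
            (dirDeriv (stdVec j) (hessianCofactor a i j) x * φ x) =
        - ∫ x, hessianCofactor a i j x *
          dirDeriv (stdVec j) (dirDeriv (stdVec i) v) x * φ x := by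
      intro j
      have h := integral_mul_dirDeriv_eq_neg (μ := volume) (hv1 i) ((hc i j).mul hφ')
        hcφ.mul_left (stdVec j)
      refine Eq.trans ?_ (h.trans ?_)
      · refine integral_congr_ae (Filter.Eventually.of_forall fun x => ?_)
        simp only []
        rw [dirDeriv_mul ((hc i j).differentiable (by simp) x)
          (hφ'.differentiable (by simp) x)]
        ring
      · congr 1
        refine integral_congr_ae (Filter.Eventually.of_forall fun x => ?_)
        simp only []; ring
    have e2 : ∑ j, ∫ x, dirDeriv (stdVec i) v x * (hessianCofactor a i j x *
          dirDeriv (stdVec j) φ x) + dirDeriv (stdVec i) v x *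
            (dirDeriv (stdVec j) (hessianCofactor a i j) x * φ x) =
        ∑ j, - ∫ x, hessianCofactor a i j x *
          dirDeriv (stdVec j) (dirDeriv (stdVec i) v) x * φ x :=
      Finset.sum_congr rfl fun j _ => e j
    rw [← integral_finsetSum, Finset.sum_neg_distrib, ← integral_finsetSum] at e2
    · have e3 : ∀ x, ∑ j, (dirDeriv (stdVec i) v x * (hessianCofactor a i j x *
          dirDeriv (stdVec j) φ x) + dirDeriv (stdVec i) v x *
            (dirDeriv (stdVec j) (hessianCofactor a i j) x * φ x)) =
          dirDeriv (stdVec i) v x * ∑ j, hessianCofactor a i j x * dirDeriv (stdVec j) φ x := by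
        -- The terms in which a derivative falls on a cofactor cancel by the Piola identity, for
        -- fixed row `i`.
        intro x
        rw [Finset.sum_add_distrib, ← Finset.mul_sum, ← Finset.mul_sum, ← Finset.sum_mul,
          sum_dirDeriv_hessianCofactor_eq_zero ha]
        simp
      simp only [e3] at e2
      rw [e2, neg_neg]
      simp only [Finset.sum_mul]
    · intro j _
      exact int ((hc i j).continuous.mul (cd j (hv1 i))) hφ.continuous hcφ
    · intro j _
      refine Integrable.add ?_ ?_
      · simp only [← mul_assoc]
        exact int ((hv1 i).continuous.mul (hc i j).continuous) (cd j hφ') (hcφ.dirDeriv _)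
      · simp only [← mul_assoc]
        exact int ((hv1 i).continuous.mul (cd j (hc i j))) hφ.continuous hcφ
  -- second integration by parts
  have s2 : ∀ j, ∫ x, ∑ i, dirDeriv (stdVec i) v x * (hessianCofactor a i j x *
        dirDeriv (stdVec j) φ x) =
      - ∫ x, v x * ∑ i, hessianCofactor a i j x *
        dirDeriv (stdVec i) (dirDeriv (stdVec j) φ) x := by
    intro j
    have e : ∀ i, ∫ x, v x * (hessianCofactor a i j x *
          dirDeriv (stdVec i) (dirDeriv (stdVec j) φ) x) + v x *
            (dirDeriv (stdVec i) (hessianCofactor a i j) x * dirDeriv (stdVec j) φ x) =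
        - ∫ x, dirDeriv (stdVec i) v x * (hessianCofactor a i j x *
          dirDeriv (stdVec j) φ x) := by
      intro i
      have h := integral_mul_dirDeriv_eq_neg (μ := volume) hv' ((hc i j).mul (hφ1 j))
        (hcφ.dirDeriv _).mul_left (stdVec i)
      refine Eq.trans ?_ h
      refine integral_congr_ae (Filter.Eventually.of_forall fun x => ?_)
      simp only []
      rw [dirDeriv_mul ((hc i j).differentiable (by simp) x)
        ((hφ1 j).differentiable (by simp) x)]
      ring
    have e2 := Finset.sum_congr (rfl : (Finset.univ : Finset (Fin N)) = Finset.univ)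
      fun i _ => e i
    rw [← integral_finsetSum, Finset.sum_neg_distrib, ← integral_finsetSum] at e2
    · have e3 : ∀ x, ∑ i, (v x * (hessianCofactor a i j x *
          dirDeriv (stdVec i) (dirDeriv (stdVec j) φ) x) + v x *
            (dirDeriv (stdVec i) (hessianCofactor a i j) x * dirDeriv (stdVec j) φ x)) =
          v x * ∑ i, hessianCofactor a i j x *
            dirDeriv (stdVec i) (dirDeriv (stdVec j) φ) x := by
        intro x
        -- Here the divergence runs over the first index, so symmetry of the cofactors is needed
        -- before the Piola identity applies.
        have hz : ∑ i, dirDeriv (stdVec i) (hessianCofactor a i j) x = 0 := by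
          rw [← sum_dirDeriv_hessianCofactor_eq_zero ha j x]
          refine Finset.sum_congr rfl fun i _ => ?_
          congr 1
          ext y
          exact hessianCofactor_symm ha2.contDiffAt i j
        rw [Finset.sum_add_distrib, ← Finset.mul_sum, ← Finset.mul_sum, ← Finset.sum_mul, hz]
        simp
      simp only [e3] at e2
      rw [e2, neg_neg]
    · intro i _
      simp only [← mul_assoc]
      exact int ((hv1 i).continuous.mul (hc i j).continuous) (cd j hφ') (hcφ.dirDeriv _)
    · intro i _
      refine Integrable.add ?_ ?_
      · simp only [← mul_assoc]
        exact int (hv.continuous.mul (hc i j).continuous) (cd i (hφ1 j))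
          ((hcφ.dirDeriv _).dirDeriv _)
      · simp only [← mul_assoc]
        exact int (hv.continuous.mul (cd i (hc i j))) (cd j hφ') (hcφ.dirDeriv _)
  have hexp : ∀ x, (∑ i, ((hessianMatrix a x).updateRow i fun j => hessianMatrix v x i j).det) *
      φ x = ∑ i, (∑ j, hessianCofactor a i j x *
        dirDeriv (stdVec j) (dirDeriv (stdVec i) v) x) * φ x := by
    intro x
    rw [Finset.sum_mul]
    refine Finset.sum_congr rfl fun i _ => ?_
    congr 1
    rw [det_updateRow_eq_sum]
    refine Finset.sum_congr rfl fun j _ => ?_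
    rw [hessianMatrix_symm hv.contDiffAt, hessianMatrix_eq_dirDeriv hv.contDiffAt, mul_comm]
    rfl
  simp only [hexp]
  rw [integral_finsetSum]
  · rw [Finset.sum_congr rfl fun i _ => s1 i, Finset.sum_neg_distrib, ← integral_finsetSum]
    · have hsw : ∀ x, ∑ i, dirDeriv (stdVec i) v x * ∑ j, hessianCofactor a i j x *
          dirDeriv (stdVec j) φ x = ∑ j, ∑ i, dirDeriv (stdVec i) v x *
            (hessianCofactor a i j x * dirDeriv (stdVec j) φ x) := by
        intro x
        simp only [Finset.mul_sum]
        exact Finset.sum_comm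
      simp only [hsw]
      rw [integral_finsetSum, Finset.sum_congr rfl fun j _ => s2 j, Finset.sum_neg_distrib,
        neg_neg, ← integral_finsetSum]
      · refine integral_congr_ae (Filter.Eventually.of_forall fun x => ?_)
        simp only []
        rw [← Finset.mul_sum, Finset.sum_comm]
        simp only [hessianMatrix_eq_dirDeriv hφ.contDiffAt]
      · intro j _
        simp only [Finset.mul_sum, ← mul_assoc]
        refine integrable_finsetSum _ fun i _ => ?_
        exact int (hv.continuous.mul (hc i j).continuous) (cd i (hφ1 j))
          ((hcφ.dirDeriv _).dirDeriv _)
      · intro j _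
        simp only [← mul_assoc]
        refine integrable_finsetSum _ fun i _ => ?_
        exact int ((hv1 i).continuous.mul (hc i j).continuous) (cd j hφ') (hcφ.dirDeriv _)
    · intro i _
      simp only [Finset.mul_sum, ← mul_assoc]
      refine integrable_finsetSum _ fun j _ => ?_
      exact int ((hv1 i).continuous.mul (hc i j).continuous) (cd j hφ') (hcφ.dirDeriv _)
  · intro i _
    refine int ?_ hφ.continuous hcφ
    exact continuous_finsetSum _ fun j _ => (hc i j).continuous.mul (cd j (hv1 i))

end Hessian

/-! ### The mollification as a function of scale and position. -/

section Mollification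

open scoped Convolution ContDiff
open Metric Set

/-- Euclidean space of dimension `N`. -/
abbrev Euc (N : ℕ) : Type := EuclideanSpace ℝ (Fin N)

variable {N : ℕ}

/-- An even smooth mollifier supported in the ball of radius `1/2`. -/
noncomputable def mollifier (N : ℕ) : Euc N → ℝ :=
  (⟨1 / 4, 1 / 2, by norm_num, by norm_num⟩ : ContDiffBump (0 : Euc N)).normed volume

theorem contDiff_mollifier {n : ℕ∞} : ContDiff ℝ n (mollifier N) := ContDiffBump.contDiff_normed _

theorem mollifier_neg (x : Euc N) : mollifier N (-x) = mollifier N x :=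
  ContDiffBump.normed_neg _ x

theorem mollifier_nonneg (x : Euc N) : 0 ≤ mollifier N x := ContDiffBump.nonneg_normed _ x

theorem integral_mollifier : ∫ x, mollifier N x = 1 := ContDiffBump.integral_normed _

theorem hasCompactSupport_mollifier : HasCompactSupport (mollifier N) :=
  ContDiffBump.hasCompactSupport_normed _

theorem tsupport_mollifier_subset : tsupport (mollifier N) ⊆ ball 0 1 := by
  rw [mollifier, ContDiffBump.tsupport_normed_eq]
  exact closedBall_subset_ball (by norm_num)

theorem mollifier_eq_zero {x : Euc N} (hx : 1 ≤ ‖x‖) : mollifier N x = 0 := by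
  by_contra h
  have := tsupport_mollifier_subset (subset_tsupport _ h)
  rw [mem_ball_zero_iff] at this
  linarith

theorem fderiv_mollifier_eq_zero {x : Euc N} (hx : 1 ≤ ‖x‖) : fderiv ℝ (mollifier N) x = 0 := by
  by_contra h
  have := tsupport_mollifier_subset (support_fderiv_subset ℝ h)
  rw [mem_ball_zero_iff] at this
  linarith

theorem exists_mollifier_bound (N : ℕ) :
    ∃ K : ℝ, 0 < K ∧ ∀ x, mollifier N x ≤ K ∧ ‖fderiv ℝ (mollifier N) x‖ ≤ K := by
  obtain ⟨a, ha⟩ := hasCompactSupport_mollifier (N := N) |>.exists_bound_of_continuous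
    (contDiff_mollifier (n := 0)).continuous
  obtain ⟨b, hb⟩ := (hasCompactSupport_mollifier (N := N) |>.fderiv ℝ).exists_bound_of_continuous
    ((contDiff_mollifier (N := N) (n := 1)).continuous_fderiv (by simp))
  refine ⟨max (max a b) 1, by positivity, fun x => ⟨?_, ?_⟩⟩
  · exact (le_abs_self _).trans ((ha x).trans (by simp))
  · exact (hb x).trans (by simp)

/-- The mollifier rescaled to the ball of radius `t / 2`, with integral `1`. -/
noncomputable def mollKernel (N : ℕ) (t : ℝ) (y : Euc N) : ℝ :=
  (t ^ N)⁻¹ * mollifier N (t⁻¹ • y)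

theorem mollKernel_eq_zero {t : ℝ} (ht : 0 < t) {y : Euc N} (hy : t ≤ ‖y‖) :
    mollKernel N t y = 0 := by
  rw [mollKernel, mollifier_eq_zero, mul_zero]
  rw [norm_smul, norm_inv, Real.norm_of_nonneg ht.le, inv_mul_eq_div]
  rwa [le_div_iff₀ ht, one_mul]

theorem contDiff_mollKernel {n : ℕ∞} (t : ℝ) : ContDiff ℝ n (mollKernel N t) :=
  contDiff_const.mul (contDiff_mollifier.comp (contDiff_const_smul t⁻¹))

theorem hasCompactSupport_mollKernel {t : ℝ} (ht : 0 < t) : HasCompactSupport (mollKernel N t) :=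
  HasCompactSupport.intro (isCompact_closedBall 0 t) fun y hy =>
    mollKernel_eq_zero ht (by simp at hy; exact hy.le)

theorem dirDeriv_mollKernel (t : ℝ) (v y : Euc N) :
    dirDeriv v (mollKernel N t) y = (t ^ N)⁻¹ * (t⁻¹ * dirDeriv v (mollifier N) (t⁻¹ • y)) := by
  have h1 : HasFDerivAt (mollifier N) (fderiv ℝ (mollifier N) (t⁻¹ • y)) (t⁻¹ • y) :=
    ((contDiff_mollifier (N := N) (n := 1)).differentiable (by simp) _).hasFDerivAt
  have h2 : HasFDerivAt (fun z : Euc N => t⁻¹ • z) (t⁻¹ • ContinuousLinearMap.id ℝ (Euc N)) y :=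
    (hasFDerivAt_id y).const_smul t⁻¹
  have h3 := (h1.comp y h2).const_mul (t ^ N)⁻¹
  have h4 : fderiv ℝ (mollKernel N t) y = _ := h3.fderiv
  simp [dirDeriv, h4]

theorem dirDeriv_mollKernel_eq_zero {t : ℝ} (ht : 0 < t) (v : Euc N) {y : Euc N}
    (hy : t ≤ ‖y‖) : dirDeriv v (mollKernel N t) y = 0 := by
  rw [dirDeriv_mollKernel, dirDeriv, fderiv_mollifier_eq_zero]
  · simp
  · rw [norm_smul, norm_inv, Real.norm_of_nonneg ht.le, inv_mul_eq_div]
    rwa [le_div_iff₀ ht, one_mul]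

/-- The mollification of `f` at scale `t`. -/
noncomputable def moll (f : Euc N → ℝ) (t : ℝ) : Euc N → ℝ :=
  f ⋆[ContinuousLinearMap.mul ℝ ℝ, volume] mollKernel N t

theorem moll_apply (f : Euc N → ℝ) (t : ℝ) (x : Euc N) :
    moll f t x = ∫ y, f y * mollKernel N t (x - y) := rfl

theorem integral_comp_sub_smul (g : Euc N → ℝ) {t : ℝ} (ht : 0 < t) (x : Euc N) :
    ∫ z, g (x - t • z) = (t ^ N)⁻¹ * ∫ y, g y := by
  have h := Measure.integral_comp_smul (μ := volume) (fun w : Euc N => g (x - w)) t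
  rw [h, integral_sub_left_eq_self g volume x]
  simp [abs_of_pos ht]

/-- Substituting `y = x - t z` places the scale in the argument of `f` and leaves a fixed kernel.
This form serves to differentiate in `t` and to let `t` tend to `0`. -/
theorem moll_eq_integral_scaled (f : Euc N → ℝ) {t : ℝ} (ht : 0 < t) (x : Euc N) :
    moll f t x = ∫ z, f (x - t • z) * mollifier N z := by
  have h := integral_comp_sub_smul (fun y => f y * mollifier N (t⁻¹ • (x - y))) ht x
  simp only [sub_sub_cancel, smul_smul, inv_mul_cancel₀ ht.ne', one_smul] at h
  rw [h, moll_apply, ← integral_const_mul]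
  refine integral_congr_ae (Filter.Eventually.of_forall fun y => ?_)
  simp only [mollKernel]; ring

theorem contDiffOn_moll {f : Euc N → ℝ} (hf : LocallyIntegrable f) :
    ContDiffOn ℝ ∞ (fun q : ℝ × Euc N => moll f q.1 q.2) (Ioi 0 ×ˢ univ) := by
  rintro ⟨t, x⟩ ⟨ht, -⟩
  replace ht : 0 < t := ht
  -- Restricting scales to `(0, t + 1)` gives all the kernels one common compact support, as the
  -- parametric convolution theorem requires.
  have hk : ContDiffOn ℝ ∞ (Function.uncurry (mollKernel N)) (Ioo 0 (t + 1) ×ˢ univ) := by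
    have h1 : ContDiffOn ℝ ∞ (fun q : ℝ × Euc N => q.1⁻¹) (Ioo 0 (t + 1) ×ˢ univ) :=
      contDiffOn_fst.inv fun q hq => hq.1.1.ne'
    have h2 : ContDiffOn ℝ ∞ (fun q : ℝ × Euc N => (q.1 ^ N)⁻¹) (Ioo 0 (t + 1) ×ˢ univ) :=
      (contDiffOn_fst.pow N).inv fun q hq => pow_ne_zero _ hq.1.1.ne'
    exact h2.mul (contDiff_mollifier.comp_contDiffOn (h1.smul contDiffOn_snd))
  have h := contDiffOn_convolution_right_with_param (n := ⊤) (μ := volume)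
    (ContinuousLinearMap.mul ℝ ℝ) (g := mollKernel N) (isOpen_Ioo (a := 0) (b := t + 1))
    (isCompact_closedBall (0 : Euc N) (t + 1))
    (fun p y hp hy => mollKernel_eq_zero hp.1 (by
      simp at hy; exact hp.2.le.trans hy.le)) hf hk
  exact (h.contDiffAt ((isOpen_Ioo.prod isOpen_univ).mem_nhds
    ⟨⟨ht, by simp⟩, mem_univ _⟩)).contDiffWithinAt

theorem contDiff_moll {f : Euc N → ℝ} (hf : LocallyIntegrable f) {t : ℝ} (ht : 0 < t) {n : ℕ∞} :
    ContDiff ℝ n (moll f t) :=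
  (hasCompactSupport_mollKernel ht).contDiff_convolution_right _ hf (contDiff_mollKernel t)

theorem dirDeriv_moll {f : Euc N → ℝ} (hf : ContDiff ℝ 1 f) (hcf : HasCompactSupport f) {t : ℝ}
    (v : Euc N) : dirDeriv v (moll f t) = moll (dirDeriv v f) t := by
  ext x
  have hk : LocallyIntegrable (mollKernel N t) :=
    (contDiff_mollKernel (n := 0) t).continuous.locallyIntegrable
  have h := hcf.hasFDerivAt_convolution_left (μ := volume) (ContinuousLinearMap.mul ℝ ℝ) hf hk x
  rw [dirDeriv, moll, h.fderiv]
  have hi := (hcf.fderiv ℝ).convolutionExists_left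
    (ContinuousLinearMap.precompL (Euc N) (ContinuousLinearMap.mul ℝ ℝ)) (μ := volume)
    (hf.continuous_fderiv (by simp)) hk x
  rw [convolution_def, ContinuousLinearMap.integral_apply hi]
  rfl

theorem dirDeriv_moll_eq_integral {f : Euc N → ℝ} (hf : LocallyIntegrable f) {t : ℝ}
    (ht : 0 < t) (v x : Euc N) :
    dirDeriv v (moll f t) x = ∫ y, f y * dirDeriv v (mollKernel N t) (x - y) := by
  have hc := hasCompactSupport_mollKernel (N := N) ht
  have hk : ContDiff ℝ 1 (mollKernel N t) := contDiff_mollKernel (n := 1) t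
  have h := hc.hasFDerivAt_convolution_right (μ := volume) (ContinuousLinearMap.mul ℝ ℝ) hf hk x
  rw [dirDeriv, moll, h.fderiv]
  rw [convolution_precompR_apply _ hf (hc.fderiv ℝ) (hk.continuous_fderiv (by simp))]
  rfl

theorem integral_dirDeriv_eq_zero {f : Euc N → ℝ} (hf : ContDiff ℝ 1 f)
    (hcf : HasCompactSupport f) (v : Euc N) : ∫ x, dirDeriv v f x = 0 := by
  have h := integral_mul_dirDeriv_eq_neg (μ := volume) (f := fun _ => (1 : ℝ)) contDiff_const
    hf hcf v
  simpa [dirDeriv] using h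

/-- The derivative of the kernel has integral zero, so the constant `f x` may be subtracted from
`f`. The kernel derivative has size `t^(-N-1)` and lives on the ball of radius `t`. -/
theorem abs_dirDeriv_moll_le {K : ℝ} (hK : ∀ x, ‖fderiv ℝ (mollifier N) x‖ ≤ K)
    {f : Euc N → ℝ} (hf : Continuous f) {t : ℝ} (ht : 0 < t) (v x : Euc N) :
    |dirDeriv v (moll f t) x| ≤
      K * ‖v‖ * t⁻¹ * ((t ^ N)⁻¹ * ∫ y in ball x t, |f y - f x|) := by
  have hk : ContDiff ℝ 1 (mollKernel N t) := contDiff_mollKernel (n := 1) t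
  have hkd : Continuous (dirDeriv v (mollKernel N t)) :=
    (hk.dirDeriv (m := 0) (by simp) v).continuous
  have hcd := (hasCompactSupport_mollKernel (N := N) ht).dirDeriv v
  have hz : ∫ y, f x * dirDeriv v (mollKernel N t) (x - y) = 0 := by
    rw [integral_const_mul, integral_sub_left_eq_self (dirDeriv v (mollKernel N t)) volume x,
      integral_dirDeriv_eq_zero hk (hasCompactSupport_mollKernel ht), mul_zero]
  have hcomp : HasCompactSupport fun y => dirDeriv v (mollKernel N t) (x - y) :=
    hcd.comp_homeomorph (Homeomorph.subLeft x)
  have hcont : Continuous fun y => dirDeriv v (mollKernel N t) (x - y) :=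
    hkd.comp (continuous_const.sub continuous_id)
  have e : dirDeriv v (moll f t) x =
      ∫ y, (f y - f x) * dirDeriv v (mollKernel N t) (x - y) := by
    rw [dirDeriv_moll_eq_integral hf.locallyIntegrable ht]
    simp only [sub_mul]
    rw [integral_sub, hz, sub_zero]
    · exact (hf.mul hcont).integrable_of_hasCompactSupport hcomp.mul_left
    · exact (continuous_const.mul hcont).integrable_of_hasCompactSupport hcomp.mul_left
  have hsupp : ∀ y, y ∉ ball x t → (f y - f x) * dirDeriv v (mollKernel N t) (x - y) = 0 := by
    intro y hy
    rw [dirDeriv_mollKernel_eq_zero ht, mul_zero]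
    rw [mem_ball, not_lt, dist_comm, dist_eq_norm] at hy
    exact hy
  rw [e, ← setIntegral_eq_integral_of_forall_compl_eq_zero hsupp]
  have hint : IntegrableOn (fun y => |f y - f x|) (ball x t) :=
    ((hf.sub continuous_const).abs.continuousOn.integrableOn_compact
      (isCompact_closedBall x t)).mono_set ball_subset_closedBall
  calc |∫ y in ball x t, (f y - f x) * dirDeriv v (mollKernel N t) (x - y)|
      ≤ ∫ y in ball x t, (K * ‖v‖ * t⁻¹ * (t ^ N)⁻¹) * |f y - f x| := by
        refine (Real.norm_eq_abs _).ge.trans <| norm_integral_le_of_norm_le (hint.const_mul _)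
          (Filter.Eventually.of_forall fun y => ?_)
        rw [dirDeriv_mollKernel, norm_mul, mul_comm (‖f y - f x‖)]
        refine mul_le_mul_of_nonneg_right ?_ (abs_nonneg _)
        rw [norm_mul, norm_mul, Real.norm_of_nonneg (by positivity : 0 ≤ (t ^ N)⁻¹),
          Real.norm_of_nonneg (by positivity : 0 ≤ t⁻¹)]
        have h1 : ‖dirDeriv v (mollifier N) (t⁻¹ • (x - y))‖ ≤ K * ‖v‖ :=
          (ContinuousLinearMap.le_opNorm _ _).trans (by gcongr; exact hK _)
        calc _ ≤ (t ^ N)⁻¹ * (t⁻¹ * (K * ‖v‖)) := by gcongr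
          _ = _ := by ring
    _ = _ := by rw [integral_const_mul]; ring

theorem hasDerivAt_moll {f : Euc N → ℝ} (hf : ContDiff ℝ 1 f) (hcf : HasCompactSupport f)
    {t : ℝ} (ht : 0 < t) (x : Euc N) :
    HasDerivAt (fun s => moll f s x)
      (∫ z, -(fderiv ℝ f (x - t • z) z) * mollifier N z) t := by
  obtain ⟨M, hM⟩ := (hcf.fderiv ℝ).exists_bound_of_continuous (hf.continuous_fderiv (by simp))
  have hM0 : 0 ≤ M := (norm_nonneg _).trans (hM 0)
  have hρ : Continuous (mollifier N) := (contDiff_mollifier (n := 0)).continuous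
  have hd : HasDerivAt (fun s => ∫ z, f (x - s • z) * mollifier N z)
      (∫ z, -(fderiv ℝ f (x - t • z) z) * mollifier N z) t := by
    refine (hasDerivAt_integral_of_dominated_loc_of_deriv_le
      (F := fun s z => f (x - s • z) * mollifier N z)
      (F' := fun s z => -(fderiv ℝ f (x - s • z) z) * mollifier N z)
      (bound := fun z => (M * ‖z‖) * mollifier N z) (s := univ) Filter.univ_mem ?_ ?_ ?_ ?_ ?_
      ?_).2
    · refine Filter.Eventually.of_forall fun s => Continuous.aestronglyMeasurable ?_
      exact (hf.continuous.comp (by fun_prop)).mul hρ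
    · exact ((hf.continuous.comp (by fun_prop)).mul hρ).integrable_of_hasCompactSupport
        hasCompactSupport_mollifier.mul_left
    · refine Continuous.aestronglyMeasurable (Continuous.mul (Continuous.neg ?_) hρ)
      exact ((hf.continuous_fderiv (by simp)).comp (by fun_prop)).clm_apply continuous_id
    · refine Filter.Eventually.of_forall fun z s _ => ?_
      rw [norm_mul, norm_neg, Real.norm_of_nonneg (mollifier_nonneg z)]
      refine mul_le_mul_of_nonneg_right ?_ (mollifier_nonneg z)
      exact (ContinuousLinearMap.le_opNorm _ _).trans (by gcongr; exact hM _)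
    · exact ((continuous_const.mul continuous_norm).mul hρ).integrable_of_hasCompactSupport
        hasCompactSupport_mollifier.mul_left
    · refine Filter.Eventually.of_forall fun z s _ => ?_
      have h1 : HasDerivAt (fun s : ℝ => x - s • z) (-z) s := by
        simpa using ((hasDerivAt_id s).smul_const z).const_sub x
      have h2 : HasFDerivAt f (fderiv ℝ f (x - s • z)) (x - s • z) :=
        (hf.differentiable (by simp) _).hasFDerivAt
      have h3 := (h2.comp_hasDerivAt s h1).mul_const (mollifier N z)
      simpa using h3
  refine hd.congr_of_eventuallyEq ?_
  filter_upwards [Ioi_mem_nhds ht] with s hs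
  exact moll_eq_integral_scaled f hs x

/-- The mollifier is even and `z ↦ Df(x) z` is odd, so their product has integral zero and `Df(x)`
may be subtracted. Unlike a bound on second space derivatives, this costs no factor `t⁻¹`. -/
theorem abs_deriv_moll_le {K : ℝ} (hK0 : 0 ≤ K) (hK : ∀ x, mollifier N x ≤ K)
    {f : Euc N → ℝ} (hf : ContDiff ℝ 1 f) {t : ℝ} (ht : 0 < t) (x : Euc N) :
    |∫ z, -(fderiv ℝ f (x - t • z) z) * mollifier N z| ≤
      K * ((t ^ N)⁻¹ * ∫ y in ball x t, ‖fderiv ℝ f y - fderiv ℝ f x‖) := by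
  have hρ : Continuous (mollifier N) := (contDiff_mollifier (n := 0)).continuous
  have hf' : Continuous (fderiv ℝ f) := hf.continuous_fderiv (by simp)
  have hz : ∫ z, -(fderiv ℝ f x z) * mollifier N z = 0 := by
    have h := integral_neg_eq_self (fun z => -(fderiv ℝ f x z) * mollifier N z) volume
    simp only [mollifier_neg, map_neg, neg_neg] at h
    have h2 : ∫ z, -(fderiv ℝ f x z) * mollifier N z =
        - ∫ z, (fderiv ℝ f x z) * mollifier N z := by
      rw [← integral_neg]; simp
    linarith
  have e : ∫ z, -(fderiv ℝ f (x - t • z) z) * mollifier N z =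
      ∫ z, -((fderiv ℝ f (x - t • z) - fderiv ℝ f x) z) * mollifier N z := by
    rw [← sub_zero (∫ z, -(fderiv ℝ f (x - t • z) z) * mollifier N z), ← hz, ← integral_sub]
    · refine integral_congr_ae (Filter.Eventually.of_forall fun z => ?_)
      simp; ring
    · refine (Continuous.mul (Continuous.neg ?_) hρ).integrable_of_hasCompactSupport
        hasCompactSupport_mollifier.mul_left
      exact (hf'.comp (by fun_prop)).clm_apply continuous_id
    · exact (Continuous.mul (by fun_prop) hρ).integrable_of_hasCompactSupport
        hasCompactSupport_mollifier.mul_left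
  set g : Euc N → ℝ := (ball x t).indicator fun y => ‖fderiv ℝ f y - fderiv ℝ f x‖ with hg
  have hgi : Integrable g := by
    rw [hg, integrable_indicator_iff measurableSet_ball]
    exact ((hf'.sub continuous_const).norm.continuousOn.integrableOn_compact
      (isCompact_closedBall x t)).mono_set ball_subset_closedBall
  have hgi2 : Integrable fun z => g (x - t • z) :=
    ((integrable_comp_smul_iff volume (fun w => g (x - w)) ht.ne').2 (hgi.comp_sub_left x))
  rw [e]
  calc |∫ z, -((fderiv ℝ f (x - t • z) - fderiv ℝ f x) z) * mollifier N z|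
      ≤ ∫ z, K * g (x - t • z) := by
        refine (Real.norm_eq_abs _).ge.trans <| norm_integral_le_of_norm_le (hgi2.const_mul K)
          (Filter.Eventually.of_forall fun z => ?_)
        rcases le_or_gt 1 ‖z‖ with h1 | h1
        · rw [mollifier_eq_zero h1]
          simp only [mul_zero, norm_zero]
          exact mul_nonneg hK0 (indicator_nonneg (fun _ _ => norm_nonneg _) _)
        · have hmem : x - t • z ∈ ball x t := by
            rw [mem_ball, dist_eq_norm]
            simp only [sub_sub_cancel_left, norm_neg, norm_smul, Real.norm_of_nonneg ht.le]
            nlinarith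
          rw [hg, indicator_of_mem hmem, norm_mul, norm_neg,
            Real.norm_of_nonneg (mollifier_nonneg z), mul_comm]
          refine mul_le_mul (hK z) ?_ (norm_nonneg _) hK0
          refine (ContinuousLinearMap.le_opNorm _ _).trans ?_
          nlinarith [norm_nonneg (fderiv ℝ f (x - t • z) - fderiv ℝ f x)]
    _ = _ := by
        rw [integral_const_mul, integral_comp_sub_smul g ht, hg,
          integral_indicator measurableSet_ball]

/-- The time derivative of the mollification. -/
noncomputable def mollTime (f : Euc N → ℝ) (t : ℝ) (x : Euc N) : ℝ :=
  dirDeriv ((1 : ℝ), (0 : Euc N)) (fun q : ℝ × Euc N => moll f q.1 q.2) (t, x)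

theorem differentiableAt_moll {f : Euc N → ℝ} (hf : LocallyIntegrable f) {t : ℝ} (ht : 0 < t)
    (x : Euc N) : DifferentiableAt ℝ (fun q : ℝ × Euc N => moll f q.1 q.2) (t, x) :=
  have hmem : Ioi 0 ×ˢ univ ∈ nhds ((t, x) : ℝ × Euc N) :=
    (isOpen_Ioi.prod isOpen_univ).mem_nhds ⟨ht, mem_univ _⟩
  ((contDiffOn_moll hf).contDiffAt hmem).differentiableAt (by simp)

theorem hasDerivAt_moll_mollTime {f : Euc N → ℝ} (hf : LocallyIntegrable f) {t : ℝ} (ht : 0 < t)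
    (x : Euc N) : HasDerivAt (fun s => moll f s x) (mollTime f t x) t := by
  have h := (differentiableAt_moll hf ht x).hasFDerivAt
  have h2 : HasDerivAt (fun s : ℝ => (s, x)) ((1 : ℝ), (0 : Euc N)) t :=
    (hasDerivAt_id t).prodMk (hasDerivAt_const t x)
  exact h.comp_hasDerivAt t h2

theorem dirDeriv_moll_eq_dirDeriv_prod {f : Euc N → ℝ} (hf : LocallyIntegrable f) {t : ℝ}
    (ht : 0 < t) (v x : Euc N) :
    dirDeriv ((0 : ℝ), v) (fun q : ℝ × Euc N => moll f q.1 q.2) (t, x) =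
      dirDeriv v (moll f t) x := by
  have h := (differentiableAt_moll hf ht x).hasFDerivAt
  have h2 : HasFDerivAt (fun y : Euc N => (t, y)) (ContinuousLinearMap.inr ℝ ℝ (Euc N)) x :=
    hasFDerivAt_prodMk_right t x
  have h3 : HasFDerivAt (moll f t) _ x := h.comp x h2
  simp [dirDeriv, h3.fderiv]

theorem contDiffOn_mollTime {f : Euc N → ℝ} (hf : LocallyIntegrable f) :
    ContDiffOn ℝ ∞ (fun q : ℝ × Euc N => mollTime f q.1 q.2) (Ioi 0 ×ˢ univ) :=
  (contDiffOn_moll hf).dirDeriv (isOpen_Ioi.prod isOpen_univ) (by simp) _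

theorem contDiff_mollTime {f : Euc N → ℝ} (hf : LocallyIntegrable f) {t : ℝ} (ht : 0 < t) :
    ContDiff ℝ ∞ (mollTime f t) := by
  rw [← contDiffOn_univ]
  exact (contDiffOn_mollTime hf).comp (contDiffOn_const.prodMk contDiffOn_id)
    fun x _ => ⟨ht, mem_univ _⟩

/-- Mixed second derivatives of the jointly smooth map `(t, x) ↦ moll f t x` commute, and space
derivatives pass through the mollification onto `f`. -/
theorem dirDeriv_mollTime {f : Euc N → ℝ} (hf : ContDiff ℝ 1 f) (hcf : HasCompactSupport f)
    {t : ℝ} (ht : 0 < t) (v : Euc N) :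
    dirDeriv v (mollTime f t) = mollTime (dirDeriv v f) t := by
  ext x
  have hl := hf.continuous.locallyIntegrable (μ := volume)
  have hmem : Ioi 0 ×ˢ univ ∈ nhds ((t, x) : ℝ × Euc N) :=
    (isOpen_Ioi.prod isOpen_univ).mem_nhds ⟨ht, mem_univ _⟩
  have h1 : dirDeriv v (mollTime f t) x = dirDeriv ((0 : ℝ), v)
      (fun q : ℝ × Euc N => mollTime f q.1 q.2) (t, x) := by
    have h := (((contDiffOn_mollTime hl).contDiffAt hmem).differentiableAt
      (by simp)).hasFDerivAt
    have h2 : HasFDerivAt (fun y : Euc N => (t, y)) (ContinuousLinearMap.inr ℝ ℝ (Euc N)) x :=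
      hasFDerivAt_prodMk_right t x
    have h3 : HasFDerivAt (mollTime f t) _ x := h.comp x h2
    simp [dirDeriv, h3.fderiv]
  rw [h1]
  have h2 := dirDeriv_comm (((contDiffOn_moll hl).contDiffAt hmem).of_le (by norm_cast))
    ((0 : ℝ), v) ((1 : ℝ), (0 : Euc N))
  refine h2.trans ?_
  simp only [mollTime]
  have h3 : dirDeriv ((0 : ℝ), v) (fun q : ℝ × Euc N => moll f q.1 q.2) =ᶠ[nhds (t, x)]
      fun q : ℝ × Euc N => moll (dirDeriv v f) q.1 q.2 := by
    filter_upwards [hmem] with q hq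
    rw [← dirDeriv_moll hf hcf]
    exact dirDeriv_moll_eq_dirDeriv_prod hl hq.1 v q.2
  rw [dirDeriv, h3.fderiv_eq]
  rfl

theorem abs_moll_le {f : Euc N → ℝ} {M : ℝ} (hM : ∀ x, |f x| ≤ M) {t : ℝ}
    (ht : 0 < t) (x : Euc N) : |moll f t x| ≤ M := by
  have hi : Integrable (mollifier N) :=
    (contDiff_mollifier (n := 0)).continuous.integrable_of_hasCompactSupport
      hasCompactSupport_mollifier
  rw [moll_eq_integral_scaled f ht]
  calc |∫ z, f (x - t • z) * mollifier N z| ≤ ∫ z, M * mollifier N z := by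
        refine (Real.norm_eq_abs _).ge.trans <| norm_integral_le_of_norm_le (hi.const_mul M)
          (Filter.Eventually.of_forall fun z => ?_)
        rw [norm_mul, Real.norm_of_nonneg (mollifier_nonneg z)]
        exact mul_le_mul_of_nonneg_right (hM _) (mollifier_nonneg z)
    _ = M := by rw [integral_const_mul, integral_mollifier, mul_one]

theorem tendsto_moll_zero {f : Euc N → ℝ} (hf : Continuous f) {M : ℝ} (hM : ∀ x, |f x| ≤ M)
    (x : Euc N) : Filter.Tendsto (fun t => moll f t x) (nhdsWithin 0 (Ioi 0)) (nhds (f x)) := by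
  have hi : Integrable (mollifier N) :=
    (contDiff_mollifier (n := 0)).continuous.integrable_of_hasCompactSupport
      hasCompactSupport_mollifier
  have hρ : Continuous (mollifier N) := (contDiff_mollifier (n := 0)).continuous
  have h : Continuous fun t : ℝ => ∫ z, f (x - t • z) * mollifier N z := by
    refine continuous_of_dominated (bound := fun z => M * mollifier N z) ?_ ?_
      (hi.const_mul M) ?_
    · exact fun t => ((hf.comp (by fun_prop)).mul hρ).aestronglyMeasurable
    · refine fun t => Filter.Eventually.of_forall fun z => ?_
      rw [norm_mul, Real.norm_of_nonneg (mollifier_nonneg z)]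
      exact mul_le_mul_of_nonneg_right (hM _) (mollifier_nonneg z)
    · exact Filter.Eventually.of_forall fun z =>
        (hf.comp (by fun_prop)).mul continuous_const
  have h0 := (h.tendsto 0).mono_left (nhdsWithin_le_nhds (s := Ioi 0))
  simp only [zero_smul, sub_zero, integral_const_mul, integral_mollifier, mul_one] at h0
  refine h0.congr' ?_
  filter_upwards [self_mem_nhdsWithin] with t ht
  exact (moll_eq_integral_scaled f ht x).symm

end Mollification

/-! ### Evolution of the Hessian determinant in the scale variable. -/

section MollifiedHessian

open scoped ContDiff
open Metric Set

variable {N : ℕ}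

theorem hasCompactSupport_hessianMatrix {u : Euc N → ℝ} (hu : ContDiff ℝ 2 u)
    (hcu : HasCompactSupport u) (i j : Fin N) :
    HasCompactSupport fun x => hessianMatrix u x i j := by
  have h : (fun x => hessianMatrix u x i j) = dirDeriv (stdVec i) (dirDeriv (stdVec j) u) :=
    funext fun x => hessianMatrix_eq_dirDeriv hu.contDiffAt i j
  rw [h]
  exact (hcu.dirDeriv _).dirDeriv _

theorem continuous_hessianMatrix {u : Euc N → ℝ} (hu : ContDiff ℝ 2 u) (i j : Fin N) :
    Continuous fun x => hessianMatrix u x i j :=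
  (contDiff_hessianMatrix (m := 0) hu (by simp) i j).continuous

theorem hessianMatrix_moll {u : Euc N → ℝ} (hu : ContDiff ℝ 2 u) (hcu : HasCompactSupport u)
    {t : ℝ} (ht : 0 < t) (x : Euc N) (i j : Fin N) :
    hessianMatrix (moll u t) x i j = moll (fun y => hessianMatrix u y i j) t x := by
  have hs : ContDiff ℝ 2 (moll u t) := contDiff_moll (n := 2) hu.continuous.locallyIntegrable ht
  have h : (fun x => hessianMatrix u x i j) = dirDeriv (stdVec i) (dirDeriv (stdVec j) u) :=
    funext fun x => hessianMatrix_eq_dirDeriv hu.contDiffAt i j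
  rw [hessianMatrix_eq_dirDeriv hs.contDiffAt, dirDeriv_moll (hu.of_le (by norm_num)) hcu,
    dirDeriv_moll (hu.dirDeriv (by norm_num) _) (hcu.dirDeriv _), h]

theorem hessianMatrix_mollTime {u : Euc N → ℝ} (hu : ContDiff ℝ 2 u)
    (hcu : HasCompactSupport u) {t : ℝ} (ht : 0 < t) (x : Euc N) (i j : Fin N) :
    hessianMatrix (mollTime u t) x i j = mollTime (fun y => hessianMatrix u y i j) t x := by
  have hs : ContDiff ℝ 2 (mollTime u t) :=
    (contDiff_mollTime hu.continuous.locallyIntegrable ht).of_le (by norm_cast)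
  have h : (fun x => hessianMatrix u x i j) = dirDeriv (stdVec i) (dirDeriv (stdVec j) u) :=
    funext fun x => hessianMatrix_eq_dirDeriv hu.contDiffAt i j
  rw [hessianMatrix_eq_dirDeriv hs.contDiffAt, dirDeriv_mollTime (hu.of_le (by norm_num)) hcu ht,
    dirDeriv_mollTime (hu.dirDeriv (by norm_num) _) (hcu.dirDeriv _) ht, h]

/-- The time derivative of the Hessian determinant of the mollification. -/
theorem hasDerivAt_det_hessianMatrix_moll {u : Euc N → ℝ} (hu : ContDiff ℝ 2 u)
    (hcu : HasCompactSupport u) {t : ℝ} (ht : 0 < t) (x : Euc N) :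
    HasDerivAt (fun s => (hessianMatrix (moll u s) x).det)
      (∑ i, ((hessianMatrix (moll u t) x).updateRow i fun j =>
        hessianMatrix (mollTime u t) x i j).det) t := by
  have hA : ∀ i j, HasFDerivAt (fun s => hessianMatrix (moll u s) x i j)
      (ContinuousLinearMap.toSpanSingleton ℝ (hessianMatrix (mollTime u t) x i j)) t := by
    intro i j
    rw [hessianMatrix_mollTime hu hcu ht]
    have h := (hasDerivAt_moll_mollTime
      ((continuous_hessianMatrix hu i j).locallyIntegrable (μ := volume)) ht x).hasFDerivAt
    refine h.congr_of_eventuallyEq ?_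
    filter_upwards [Ioi_mem_nhds ht] with s hs
    exact hessianMatrix_moll hu hcu hs x i j
  obtain ⟨D, hD, hDv⟩ := HasFDerivAt.matrix_det hA
  have h := hD.hasDerivAt
  rw [hDv] at h
  simpa using h

/-- The derivative of the Hessian determinant of the mollification tested against `φ`, with the
space derivatives moved onto `φ`. -/
noncomputable def mollFlux (u φ : Euc N → ℝ) (t : ℝ) (x : Euc N) : ℝ :=
  mollTime u t x * ∑ i, ∑ j, hessianCofactor (moll u t) i j x * hessianMatrix φ x i j

theorem integrable_mollFlux {u φ : Euc N → ℝ} (hu : ContDiff ℝ 2 u) (hφ : ContDiff ℝ 2 φ)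
    (hcφ : HasCompactSupport φ) {t : ℝ} (ht : 0 < t) : Integrable (mollFlux u φ t) := by
  have hl := hu.continuous.locallyIntegrable (μ := volume)
  have hs : ContDiff ℝ 3 (moll u t) := contDiff_moll (n := 3) hl ht
  have h : mollFlux u φ t = fun x => ∑ i, ∑ j, mollTime u t x *
      hessianCofactor (moll u t) i j x * hessianMatrix φ x i j := by
    ext x
    simp only [mollFlux, Finset.mul_sum, mul_assoc]
  rw [h]
  refine integrable_finsetSum _ fun i _ => integrable_finsetSum _ fun j _ => ?_
  refine Continuous.integrable_of_hasCompactSupport ?_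
    (hasCompactSupport_hessianMatrix hφ hcφ i j).mul_left
  exact ((contDiff_mollTime hl ht).continuous.mul
    (contDiff_hessianCofactor (m := 1) hs (by norm_num) i j).continuous).mul
      (continuous_hessianMatrix hφ i j)

/-- The fundamental theorem of calculus in `t` at each `x`, then Fubini, then the double integration
by parts at each fixed `t`. The scales stay in `[a, b]` with `a > 0`, where everything is smooth. -/
theorem integral_det_hessianMatrix_moll_sub {u φ : Euc N → ℝ} (hu : ContDiff ℝ 2 u)
    (hcu : HasCompactSupport u) (hφ : ContDiff ℝ 2 φ) (hcφ : HasCompactSupport φ) {a b : ℝ}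
    (ha : 0 < a) (hab : a ≤ b) :
    IntegrableOn (fun t => ∫ x, mollFlux u φ t x) (Ioc a b) ∧
    (∫ x, (hessianMatrix (moll u b) x).det * φ x) - (∫ x, (hessianMatrix (moll u a) x).det * φ x) =
      ∫ t in Ioc a b, ∫ x, mollFlux u φ t x := by
  have hb : 0 < b := ha.trans_le hab
  have hpos : ∀ t ∈ Icc a b, 0 < t := fun t ht => ha.trans_le ht.1
  have hl := hu.continuous.locallyIntegrable (μ := volume)
  have hhl : ∀ i j, LocallyIntegrable (fun y => hessianMatrix u y i j) := fun i j =>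
    (continuous_hessianMatrix hu i j).locallyIntegrable
  obtain ⟨g', hg'⟩ : ∃ g' : ℝ → Euc N → ℝ, ∀ t x, g' t x =
      ∑ i, ((hessianMatrix (moll u t) x).updateRow i fun j =>
        hessianMatrix (mollTime u t) x i j).det := ⟨_, fun _ _ => rfl⟩
  have hg'c : ContinuousOn (fun q : ℝ × Euc N => g' q.1 q.2) (Icc a b ×ˢ univ) := by
    simp only [hg']
    refine continuousOn_finsetSum _ fun i _ => ?_
    refine (contDiffOn_zero (𝕜 := ℝ)).1 (ContDiffOn.matrix_det fun k l => contDiffOn_zero.2 ?_)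
    have hsub : Icc a b ×ˢ (univ : Set (Euc N)) ⊆ Ioi 0 ×ˢ univ :=
      prod_mono (fun t ht => hpos t ht) subset_rfl
    by_cases hk : k = i
    · subst hk
      refine ((contDiffOn_mollTime (hhl k l)).continuousOn.mono hsub).congr fun q hq => ?_
      simp only [Matrix.updateRow_self]
      exact hessianMatrix_mollTime hu hcu (hpos _ hq.1) _ _ _
    · refine ((contDiffOn_moll (hhl k l)).continuousOn.mono hsub).congr fun q hq => ?_
      simp only [Matrix.updateRow_ne hk]
      exact hessianMatrix_moll hu hcu (hpos _ hq.1) _ _ _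
  have hdetc : ∀ t, 0 < t → Continuous fun x => (hessianMatrix (moll u t) x).det := by
    intro t ht
    have hs : ContDiff ℝ 2 (moll u t) := contDiff_moll (n := 2) hl ht
    exact Continuous.matrix_det (continuous_matrix fun i j => continuous_hessianMatrix hs i j)
  have hdet : ∀ t, 0 < t → Integrable fun x => (hessianMatrix (moll u t) x).det * φ x :=
    fun t ht => ((hdetc t ht).mul hφ.continuous).integrable_of_hasCompactSupport hcφ.mul_left
  have hftc : ∀ x, (hessianMatrix (moll u b) x).det - (hessianMatrix (moll u a) x).det =
      ∫ t in Ioc a b, g' t x := by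
    intro x
    rw [← intervalIntegral.integral_of_le hab]
    refine (intervalIntegral.integral_eq_sub_of_hasDerivAt
      (f := fun t => (hessianMatrix (moll u t) x).det) (f' := fun t => g' t x)
      (fun t ht => ?_) ?_).symm
    · rw [uIcc_of_le hab] at ht
      rw [hg']
      exact hasDerivAt_det_hessianMatrix_moll hu hcu (hpos t ht) x
    · refine ContinuousOn.intervalIntegrable ?_
      rw [uIcc_of_le hab]
      have hx : ContinuousOn (fun t : ℝ => (t, x)) (Icc a b) := by fun_prop
      exact hg'c.comp hx fun t ht => ⟨ht, mem_univ _⟩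
  have hint : Integrable (fun p : ℝ × Euc N => g' p.1 p.2 * φ p.2)
      ((volume.restrict (Ioc a b)).prod volume) := by
    -- Integrability for Fubini: the integrand is continuous on the compact set `[a, b] × tsupport
    -- φ` and vanishes on the rest of the strip.
    have h1 : IntegrableOn (fun p : ℝ × Euc N => g' p.1 p.2 * φ p.2) (Icc a b ×ˢ tsupport φ)
        (volume.prod volume) := by
      refine ContinuousOn.integrableOn_compact (isCompact_Icc.prod hcφ) ?_
      exact (hg'c.mono (prod_mono subset_rfl (subset_univ _))).mul
        (hφ.continuous.comp continuous_snd).continuousOn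
    have h2 : IntegrableOn (fun p : ℝ × Euc N => g' p.1 p.2 * φ p.2) (Icc a b ×ˢ univ)
        (volume.prod volume) := by
      refine h1.of_forall_sdiff_eq_zero (measurableSet_Icc.prod MeasurableSet.univ) ?_
      rintro ⟨t, x⟩ ⟨⟨ht, -⟩, hn⟩
      have : x ∉ tsupport φ := fun h => hn ⟨ht, h⟩
      simp [image_eq_zero_of_notMem_tsupport this]
    have h3 := h2.mono_set (prod_mono (Ioc_subset_Icc_self (a := a) (b := b))
      (subset_refl (univ : Set (Euc N))))
    rwa [IntegrableOn, ← Measure.prod_restrict, Measure.restrict_univ] at h3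
  have hflux : ∀ t ∈ Ioc a b, ∫ x, g' t x * φ x = ∫ x, mollFlux u φ t x := by
    intro t ht
    have ht0 := hpos t (Ioc_subset_Icc_self ht)
    simp only [hg']
    exact integral_sum_det_updateRow_hessian (contDiff_moll (n := 3) hl ht0)
      ((contDiff_mollTime hl ht0).of_le (by norm_cast)) hφ hcφ
  have hfluxae : (fun t => ∫ x, g' t x * φ x) =ᵐ[volume.restrict (Ioc a b)]
      fun t => ∫ x, mollFlux u φ t x :=
    (ae_restrict_iff' measurableSet_Ioc).2 (Filter.Eventually.of_forall hflux)
  refine ⟨(hint.integral_prod_left).congr hfluxae, ?_⟩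
  rw [← integral_congr_ae hfluxae, integral_integral_swap hint,
    ← integral_sub (hdet b hb) (hdet a ha)]
  refine integral_congr_ae (Filter.Eventually.of_forall fun x => ?_)
  simp only [← sub_mul, hftc]
  rw [integral_mul_const]

/-- Change of the tested Hessian determinants between two scales. -/
theorem enorm_integral_det_sub_le {u₁ u₂ φ : Euc N → ℝ} (hu₁ : ContDiff ℝ 2 u₁)
    (hcu₁ : HasCompactSupport u₁) (hu₂ : ContDiff ℝ 2 u₂) (hcu₂ : HasCompactSupport u₂)
    (hφ : ContDiff ℝ 2 φ) (hcφ : HasCompactSupport φ) {a b : ℝ} (ha : 0 < a) (hab : a ≤ b) :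
    ‖((∫ x, (hessianMatrix (moll u₁ b) x).det * φ x) -
        (∫ x, (hessianMatrix (moll u₂ b) x).det * φ x)) -
      ((∫ x, (hessianMatrix (moll u₁ a) x).det * φ x) -
        (∫ x, (hessianMatrix (moll u₂ a) x).det * φ x))‖ₑ ≤
      ∫⁻ t in Ioi 0, ∫⁻ x, ‖mollFlux u₁ φ t x - mollFlux u₂ φ t x‖ₑ := by
  obtain ⟨i1, e1⟩ := integral_det_hessianMatrix_moll_sub hu₁ hcu₁ hφ hcφ ha hab
  obtain ⟨i2, e2⟩ := integral_det_hessianMatrix_moll_sub hu₂ hcu₂ hφ hcφ ha hab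
  rw [sub_sub_sub_comm, e1, e2, ← integral_sub i1 i2]
  refine (enorm_integral_le_lintegral_enorm _).trans ?_
  have hsub : Ioc a b ⊆ Ioi 0 := fun t ht => ha.trans ht.1
  refine le_trans ?_ (lintegral_mono_set hsub)
  refine setLIntegral_mono_ae' measurableSet_Ioc (Filter.Eventually.of_forall fun t ht => ?_)
  rw [← integral_sub (integrable_mollFlux hu₁ hφ hcφ (hsub ht))
    (integrable_mollFlux hu₂ hφ hcφ (hsub ht))]
  exact enorm_integral_le_lintegral_enorm _

end MollifiedHessian

/-! ### Pointwise bounds by gradient oscillations, and the limits in scale. -/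

section PointwiseBounds

open scoped ContDiff
open Metric Set

variable {N : ℕ}

theorem norm_stdVec (i : Fin N) : ‖stdVec i‖ = 1 := by simp

/-- The mean oscillation of the gradient on the ball of radius `t` around `x`, up to the constant
volume of the unit ball. -/
noncomputable def gradOsc (u : Euc N → ℝ) (t : ℝ) (x : Euc N) : ℝ :=
  (t ^ N)⁻¹ * ∫ y in ball x t, ‖fderiv ℝ u y - fderiv ℝ u x‖

theorem gradOsc_nonneg (u : Euc N → ℝ) {t : ℝ} (ht : 0 < t) (x : Euc N) : 0 ≤ gradOsc u t x :=
  mul_nonneg (by positivity) (integral_nonneg fun _ => norm_nonneg _)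

theorem integrableOn_gradOsc {u : Euc N → ℝ} (hu : ContDiff ℝ 1 u) (t : ℝ) (x : Euc N) :
    IntegrableOn (fun y => ‖fderiv ℝ u y - fderiv ℝ u x‖) (ball x t) :=
  (((hu.continuous_fderiv (by simp)).sub continuous_const).norm.continuousOn.integrableOn_compact
    (isCompact_closedBall x t)).mono_set ball_subset_closedBall

theorem abs_mollTime_le {K : ℝ} (hK0 : 0 ≤ K) (hK : ∀ x, mollifier N x ≤ K)
    {u : Euc N → ℝ} (hu : ContDiff ℝ 2 u) (hcu : HasCompactSupport u) {t : ℝ} (ht : 0 < t)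
    (x : Euc N) : |mollTime u t x| ≤ K * gradOsc u t x := by
  have hu1 : ContDiff ℝ 1 u := hu.of_le (by norm_num)
  rw [(hasDerivAt_moll_mollTime hu.continuous.locallyIntegrable ht x).unique
    (hasDerivAt_moll hu1 hcu ht x)]
  exact abs_deriv_moll_le hK0 hK hu1 ht x

theorem abs_hessianMatrix_moll_le {K : ℝ} (hK0 : 0 ≤ K)
    (hK : ∀ x, ‖fderiv ℝ (mollifier N) x‖ ≤ K)
    {u : Euc N → ℝ} (hu : ContDiff ℝ 2 u) (hcu : HasCompactSupport u) {t : ℝ} (ht : 0 < t)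
    (x : Euc N) (i j : Fin N) : |hessianMatrix (moll u t) x i j| ≤ K * t⁻¹ * gradOsc u t x := by
  have hu1 : ContDiff ℝ 1 u := hu.of_le (by norm_num)
  have hs : ContDiff ℝ 2 (moll u t) := contDiff_moll (n := 2) hu.continuous.locallyIntegrable ht
  have hd : Continuous (dirDeriv (stdVec j) u) := (hu1.dirDeriv (m := 0) (by simp) _).continuous
  rw [hessianMatrix_eq_dirDeriv hs.contDiffAt, dirDeriv_moll hu1 hcu]
  refine (abs_dirDeriv_moll_le hK hd ht _ _).trans ?_
  rw [gradOsc, norm_stdVec, mul_one]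
  have hmono : ∫ y in ball x t, |dirDeriv (stdVec j) u y - dirDeriv (stdVec j) u x| ≤
      ∫ y in ball x t, ‖fderiv ℝ u y - fderiv ℝ u x‖ := by
    refine integral_mono (((hd.sub continuous_const).abs.continuousOn.integrableOn_compact
      (isCompact_closedBall x t)).mono_set ball_subset_closedBall)
      (integrableOn_gradOsc hu1 t x) fun y => ?_
    have h := (fderiv ℝ u y - fderiv ℝ u x).le_opNorm (stdVec j)
    rw [norm_stdVec, mul_one] at h
    simpa [dirDeriv] using h
  gcongr

theorem moll_sub {f g : Euc N → ℝ} (hf : LocallyIntegrable f) (hg : LocallyIntegrable g) {t : ℝ}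
    (ht : 0 < t) (x : Euc N) : moll (f - g) t x = moll f t x - moll g t x := by
  have hc := hasCompactSupport_mollKernel (N := N) ht
  have hk : Continuous (mollKernel N t) := (contDiff_mollKernel (n := 0) t).continuous
  have h1 := hc.convolutionExists_right (ContinuousLinearMap.mul ℝ ℝ) hf hk x
  have h2 := hc.convolutionExists_right (ContinuousLinearMap.mul ℝ ℝ) hg hk x
  simp only [moll_apply]
  refine Eq.trans ?_ (integral_sub h1 h2)
  refine integral_congr_ae (Filter.Eventually.of_forall fun y => ?_)
  simp [sub_mul]

theorem mollTime_sub {f g : Euc N → ℝ} (hf : LocallyIntegrable f) (hg : LocallyIntegrable g)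
    {t : ℝ} (ht : 0 < t) (x : Euc N) :
    mollTime (f - g) t x = mollTime f t x - mollTime g t x := by
  have h1 := (hasDerivAt_moll_mollTime hf ht x).sub (hasDerivAt_moll_mollTime hg ht x)
  have h2 := hasDerivAt_moll_mollTime (hf.sub hg) ht x
  refine h2.unique (h1.congr_of_eventuallyEq ?_)
  filter_upwards [Ioi_mem_nhds ht] with s hs
  exact moll_sub hf hg hs x

theorem hessianMatrix_sub {u v : Euc N → ℝ} (hu : ContDiff ℝ 2 u) (hv : ContDiff ℝ 2 v)
    (x : Euc N) (i j : Fin N) :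
    hessianMatrix (u - v) x i j = hessianMatrix u x i j - hessianMatrix v x i j := by
  have h1 : fderiv ℝ (u - v) = fderiv ℝ u - fderiv ℝ v := by
    ext1 y
    exact fderiv_sub (hu.differentiable (by simp) y) (hv.differentiable (by simp) y)
  have h2 : fderiv ℝ (fderiv ℝ u - fderiv ℝ v) x =
      fderiv ℝ (fderiv ℝ u) x - fderiv ℝ (fderiv ℝ v) x :=
    fderiv_sub ((hu.fderiv_right (m := 1) (by norm_num)).differentiable (by simp) x)
      ((hv.fderiv_right (m := 1) (by norm_num)).differentiable (by simp) x)
  simp [hessianMatrix, h1, h2]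

theorem hessianMatrix_moll_sub {u v : Euc N → ℝ} (hu : ContDiff ℝ 2 u) (hv : ContDiff ℝ 2 v)
    {t : ℝ} (ht : 0 < t) (x : Euc N) (i j : Fin N) :
    hessianMatrix (moll (u - v) t) x i j =
      hessianMatrix (moll u t) x i j - hessianMatrix (moll v t) x i j := by
  have hul := hu.continuous.locallyIntegrable (μ := volume)
  have hvl := hv.continuous.locallyIntegrable (μ := volume)
  have h : moll (u - v) t = moll u t - moll v t := funext fun y => moll_sub hul hvl ht y
  rw [h, hessianMatrix_sub (contDiff_moll (n := 2) hul ht) (contDiff_moll (n := 2) hvl ht)]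

/-- The factor `c`, later `∂ₜu_t`, is absorbed into the unit row after division by `t`. All entries
of the resulting matrix then have the same size `osc / t`, so a single Lipschitz estimate for the
determinant covers the whole product. -/
theorem smul_hessianCofactor_eq (a : Euc N → ℝ) {t : ℝ} (ht : 0 < t) (c : ℝ) (i j : Fin N)
    (x : Euc N) : c * hessianCofactor a i j x =
      t * ((hessianMatrix a x).updateRow i (Pi.single j (t⁻¹ * c))).det := by
  have h : (Pi.single j (t⁻¹ * c) : Fin N → ℝ) = (t⁻¹ * c) • Pi.single j 1 := by
    rw [← Pi.single_smul]; simp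
  rw [h, Matrix.det_updateRow_smul, hessianCofactor]
  field_simp

/-- In the constant, `N * N` counts the pairs `(i, j)`, `N! * N` comes from the Lipschitz bound for
the determinant, and `K ^ N` from the bounds on its entries. -/
theorem abs_mollFlux_sub_le (hN : 1 ≤ N) {K : ℝ} (hK0 : 0 ≤ K)
    (hK : ∀ x, mollifier N x ≤ K ∧ ‖fderiv ℝ (mollifier N) x‖ ≤ K)
    {u₁ u₂ φ : Euc N → ℝ} (hu₁ : ContDiff ℝ 2 u₁)
    (hcu₁ : HasCompactSupport u₁) (hu₂ : ContDiff ℝ 2 u₂) (hcu₂ : HasCompactSupport u₂)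
    {H : ℝ} {t : ℝ} (ht : 0 < t) {x : Euc N} (hH : ∀ i j, |hessianMatrix φ x i j| ≤ H) :
    |mollFlux u₁ φ t x - mollFlux u₂ φ t x| ≤
      (N * N * N.factorial * N * K ^ N) * H * (t * (t⁻¹) ^ N * (gradOsc (u₁ - u₂) t x *
        (gradOsc u₁ t x + gradOsc u₂ t x) ^ (N - 1))) := by
  have hw : ContDiff ℝ 2 (u₁ - u₂) := hu₁.sub hu₂
  have hcw : HasCompactSupport (u₁ - u₂) := hcu₁.sub hcu₂
  have hl1 := hu₁.continuous.locallyIntegrable (μ := volume)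
  have hl2 := hu₂.continuous.locallyIntegrable (μ := volume)
  have o1 := gradOsc_nonneg u₁ ht x
  have o2 := gradOsc_nonneg u₂ ht x
  have o3 := gradOsc_nonneg (u₁ - u₂) ht x
  have ti : 0 < t⁻¹ := inv_pos.2 ht
  set M := K * t⁻¹ * (gradOsc u₁ t x + gradOsc u₂ t x) with hM
  set δ := K * t⁻¹ * gradOsc (u₁ - u₂) t x with hδ
  have hM0 : 0 ≤ M := by positivity
  have hδ0 : 0 ≤ δ := by positivity
  have hM1 : K * t⁻¹ * gradOsc u₁ t x ≤ M := by rw [hM]; gcongr; linarith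
  have hM2 : K * t⁻¹ * gradOsc u₂ t x ≤ M := by rw [hM]; gcongr; linarith
  have time : ∀ {u : Euc N → ℝ}, ContDiff ℝ 2 u → HasCompactSupport u →
      |t⁻¹ * mollTime u t x| ≤ K * t⁻¹ * gradOsc u t x := by
    intro u hu hcu
    rw [abs_mul, abs_of_pos ti]
    calc t⁻¹ * |mollTime u t x| ≤ t⁻¹ * (K * gradOsc u t x) := by
          gcongr; exact abs_mollTime_le hK0 (fun x => (hK x).1) hu hcu ht x
      _ = _ := by ring
  have hess : ∀ {u : Euc N → ℝ}, ContDiff ℝ 2 u → HasCompactSupport u → ∀ i j,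
      |hessianMatrix (moll u t) x i j| ≤ K * t⁻¹ * gradOsc u t x := fun hu hcu i j =>
    abs_hessianMatrix_moll_le hK0 (fun x => (hK x).2) hu hcu ht x i j
  have entry : ∀ (u : Euc N → ℝ) (B : ℝ), 0 ≤ B →
      |t⁻¹ * mollTime u t x| ≤ B → (∀ i j, |hessianMatrix (moll u t) x i j| ≤ B) →
      ∀ i j k l, |((hessianMatrix (moll u t) x).updateRow i
        (Pi.single j (t⁻¹ * mollTime u t x))) k l| ≤ B := by
    intro u B hB h1 h2 i j k l
    by_cases hk : k = i
    · subst hk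
      rw [Matrix.updateRow_self]
      by_cases hl : l = j
      · subst hl; simpa using h1
      · simpa [Pi.single_apply, hl] using hB
    · rw [Matrix.updateRow_ne hk]; exact h2 k l
  have key : ∀ i j, |mollTime u₁ t x * hessianCofactor (moll u₁ t) i j x -
      mollTime u₂ t x * hessianCofactor (moll u₂ t) i j x| ≤
      t * (N.factorial * N * M ^ (N - 1) * δ) := by
    intro i j
    rw [smul_hessianCofactor_eq _ ht, smul_hessianCofactor_eq _ ht, ← mul_sub, abs_mul,
      abs_of_pos ht]
    gcongr
    refine abs_det_sub_det_le hM0 hδ0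
      (entry u₁ M hM0 ((time hu₁ hcu₁).trans hM1) (fun k l => (hess hu₁ hcu₁ k l).trans hM1) i j)
      (entry u₂ M hM0 ((time hu₂ hcu₂).trans hM2) (fun k l => (hess hu₂ hcu₂ k l).trans hM2) i j)
      fun k l => ?_
    -- Mollification is linear, so the difference of the two matrices is the corresponding matrix of
    -- `u₁ - u₂`.
    refine le_trans (le_of_eq ?_) (entry (u₁ - u₂) δ hδ0 (time hw hcw) (hess hw hcw) i j k l)
    by_cases hk : k = i
    · subst hk
      simp only [Matrix.updateRow_self, mollTime_sub hl1 hl2 ht, Pi.single_apply]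
      split_ifs <;> simp [mul_sub]
    · simp only [Matrix.updateRow_ne hk, hessianMatrix_moll_sub hu₁ hu₂ ht]
  have hexp : mollFlux u₁ φ t x - mollFlux u₂ φ t x = ∑ i, ∑ j,
      (mollTime u₁ t x * hessianCofactor (moll u₁ t) i j x -
      mollTime u₂ t x * hessianCofactor (moll u₂ t) i j x) * hessianMatrix φ x i j := by
    simp only [mollFlux, Finset.mul_sum, ← Finset.sum_sub_distrib]
    refine Finset.sum_congr rfl fun i _ => Finset.sum_congr rfl fun j _ => ?_
    ring
  have hterm : ∀ i j, |(mollTime u₁ t x * hessianCofactor (moll u₁ t) i j x -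
      mollTime u₂ t x * hessianCofactor (moll u₂ t) i j x) * hessianMatrix φ x i j| ≤
      t * (N.factorial * N * M ^ (N - 1) * δ) * H := by
    intro i j
    rw [abs_mul]
    exact mul_le_mul (key i j) (hH i j) (abs_nonneg _) ((abs_nonneg _).trans (key i j))
  rw [hexp]
  calc _ ≤ ∑ _i : Fin N, ∑ _j : Fin N, t * (N.factorial * N * M ^ (N - 1) * δ) * H := by
        refine (Finset.abs_sum_le_sum_abs _ _).trans (Finset.sum_le_sum fun i _ => ?_)
        exact (Finset.abs_sum_le_sum_abs _ _).trans (Finset.sum_le_sum fun j _ => hterm i j)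
    _ = _ := by
        obtain ⟨n, rfl⟩ : ∃ n, N = n + 1 := ⟨N - 1, by omega⟩
        simp only [Finset.sum_const, Finset.card_univ, Fintype.card_fin, nsmul_eq_mul, hM, hδ,
          Nat.add_sub_cancel, mul_pow, pow_succ]
        ring

theorem gradOsc_le {u : Euc N → ℝ} (hu : ContDiff ℝ 1 u) {M : ℝ}
    (hM : ∀ x, ‖fderiv ℝ u x‖ ≤ M) {t : ℝ} (ht : 0 < t) (x : Euc N) :
    gradOsc u t x ≤ 2 * M * volume.real (ball (0 : Euc N) 1) := by
  have h1 : ∫ y in ball x t, ‖fderiv ℝ u y - fderiv ℝ u x‖ ≤ ∫ _y in ball x t, 2 * M := by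
    refine integral_mono (integrableOn_gradOsc hu t x)
      (integrableOn_const (measure_ball_lt_top.ne) enorm_ne_top) fun y => ?_
    calc _ ≤ ‖fderiv ℝ u y‖ + ‖fderiv ℝ u x‖ := norm_sub_le _ _
      _ ≤ M + M := add_le_add (hM _) (hM _)
      _ = _ := by ring
  have h2 : volume.real (ball x t) = t ^ N * volume.real (ball (0 : Euc N) 1) := by
    rw [measureReal_def, Measure.addHaar_ball_of_pos volume x ht, ENNReal.toReal_mul,
      ENNReal.toReal_ofReal (by positivity)]
    simp [measureReal_def]
  rw [setIntegral_const, h2, smul_eq_mul] at h1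
  have htN : 0 < t ^ N := pow_pos ht N
  rw [gradOsc, inv_mul_le_iff₀ htN]
  linarith

theorem tendsto_integral_det_moll_zero {u φ : Euc N → ℝ} (hu : ContDiff ℝ 2 u)
    (hcu : HasCompactSupport u) (hφ : Continuous φ) (hcφ : HasCompactSupport φ) :
    Filter.Tendsto (fun t => ∫ x, (hessianMatrix (moll u t) x).det * φ x)
      (nhdsWithin 0 (Ioi 0)) (nhds (∫ x, (hessianMatrix u x).det * φ x)) := by
  have hb : ∃ M : ℝ, 0 ≤ M ∧ ∀ i j x, |hessianMatrix u x i j| ≤ M := by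
    have h : ∀ i j, ∃ M : ℝ, ∀ x, |hessianMatrix u x i j| ≤ M := fun i j =>
      (hasCompactSupport_hessianMatrix hu hcu i j).exists_bound_of_continuous
        (continuous_hessianMatrix hu i j)
    choose M hM using h
    refine ⟨∑ i, ∑ j, |M i j|, by positivity, fun i j x => (hM i j x).trans ?_⟩
    calc M i j ≤ |M i j| := le_abs_self _
      _ ≤ ∑ j, |M i j| := Finset.single_le_sum (fun j _ => abs_nonneg (M i j)) (Finset.mem_univ j)
      _ ≤ _ := Finset.single_le_sum (f := fun i => ∑ j, |M i j|)
        (fun i _ => Finset.sum_nonneg fun j _ => abs_nonneg (M i j)) (Finset.mem_univ i)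
  obtain ⟨M, hM0, hM⟩ := hb
  refine tendsto_integral_filter_of_dominated_convergence
    (fun x => N.factorial * M ^ N * |φ x|) ?_ ?_ ?_ ?_
  · filter_upwards [self_mem_nhdsWithin] with t ht
    have hs : ContDiff ℝ 2 (moll u t) :=
      contDiff_moll (n := 2) hu.continuous.locallyIntegrable ht
    exact ((Continuous.matrix_det (continuous_matrix fun i j =>
      continuous_hessianMatrix hs i j)).mul hφ).aestronglyMeasurable
  · filter_upwards [self_mem_nhdsWithin] with t ht
    refine Filter.Eventually.of_forall fun x => ?_
    rw [norm_mul, Real.norm_eq_abs, Real.norm_eq_abs]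
    gcongr
    refine abs_det_le hM0 fun i j => ?_
    rw [hessianMatrix_moll hu hcu ht]
    exact abs_moll_le (hM i j) ht x
  · exact (hφ.integrable_of_hasCompactSupport hcφ).abs.const_mul _
  · refine Filter.Eventually.of_forall fun x => Filter.Tendsto.mul_const _ ?_
    have hA : Filter.Tendsto (fun t => (Matrix.of fun i j =>
        moll (fun y => hessianMatrix u y i j) t x))
        (nhdsWithin 0 (Ioi 0)) (nhds (hessianMatrix u x)) := by
      refine tendsto_pi_nhds.2 fun i => tendsto_pi_nhds.2 fun j => ?_
      exact tendsto_moll_zero (continuous_hessianMatrix hu i j) (hM i j) x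
    have hdet : Continuous fun A : Matrix (Fin N) (Fin N) ℝ => A.det :=
      continuous_id.matrix_det
    refine ((hdet.tendsto _).comp hA).congr' ?_
    filter_upwards [self_mem_nhdsWithin] with t ht
    simp only [Function.comp]
    congr 1
    ext i j
    exact (hessianMatrix_moll hu hcu ht x i j).symm

/-- The oscillation of `Du` is bounded uniformly in `t`, so the entries of `D² u_t` are `O(1/t)` and
the determinant is `O(t^(-N))`. -/
theorem tendsto_integral_det_moll_atTop (hN : 1 ≤ N) {u φ : Euc N → ℝ} (hu : ContDiff ℝ 2 u)
    (hcu : HasCompactSupport u) (hφ : Continuous φ) (hcφ : HasCompactSupport φ) :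
    Filter.Tendsto (fun t => ∫ x, (hessianMatrix (moll u t) x).det * φ x)
      Filter.atTop (nhds 0) := by
  obtain ⟨K, hK0, hK⟩ := exists_mollifier_bound N
  have hu1 : ContDiff ℝ 1 u := hu.of_le (by norm_num)
  obtain ⟨M, hM⟩ := (hcu.fderiv ℝ).exists_bound_of_continuous (hu1.continuous_fderiv (by simp))
  have hM0 : 0 ≤ M := (norm_nonneg _).trans (hM 0)
  set B := K * (2 * M * volume.real (ball (0 : Euc N) 1)) with hB
  have hB0 : 0 ≤ B := by positivity
  have hi : Integrable fun x => |φ x| := (hφ.integrable_of_hasCompactSupport hcφ).abs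
  have hbound : ∀ t : ℝ, 0 < t → ‖∫ x, (hessianMatrix (moll u t) x).det * φ x‖ ≤
      N.factorial * (B * t⁻¹) ^ N * ∫ x, |φ x| := by
    intro t ht
    have ti : 0 < t⁻¹ := inv_pos.2 ht
    rw [← integral_const_mul]
    refine norm_integral_le_of_norm_le (hi.const_mul _) (Filter.Eventually.of_forall fun x => ?_)
    rw [norm_mul, Real.norm_eq_abs, Real.norm_eq_abs]
    gcongr
    refine abs_det_le (by positivity) fun i j => ?_
    refine (abs_hessianMatrix_moll_le hK0.le (fun x => (hK x).2) hu hcu ht x i j).trans ?_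
    calc K * t⁻¹ * gradOsc u t x
        ≤ K * t⁻¹ * (2 * M * volume.real (ball (0 : Euc N) 1)) := by
          gcongr; exact gradOsc_le hu1 hM ht x
      _ = B * t⁻¹ := by rw [hB]; ring
  refine squeeze_zero_norm' (Filter.eventually_atTop.2 ⟨1, fun t ht =>
    hbound t (zero_lt_one.trans_le ht)⟩) ?_
  have h : Filter.Tendsto (fun t : ℝ => N.factorial * (B * t⁻¹) ^ N * ∫ x, |φ x|) Filter.atTop
      (nhds (N.factorial * (B * 0) ^ N * ∫ x, |φ x|)) :=
    (((tendsto_inv_atTop_zero.const_mul B).pow N).const_mul _).mul_const _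
  simpa [zero_pow (show N ≠ 0 by omega)] using h

end PointwiseBounds

/-! ### From gradient oscillations to the Gagliardo seminorm. -/

section IntegralBounds

open Metric Set

variable {N : ℕ}

/-- The mean oscillation of the gradient as an extended nonnegative number. -/
noncomputable def gradEOsc (u : Euc N → ℝ) (t : ℝ) (x : Euc N) : ℝ≥0∞ :=
  ENNReal.ofReal (t ^ N)⁻¹ * ∫⁻ y in ball x t, ‖fderiv ℝ u y - fderiv ℝ u x‖ₑ

theorem ofReal_gradOsc {u : Euc N → ℝ} (hu : ContDiff ℝ 1 u) {t : ℝ} (ht : 0 < t) (x : Euc N) :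
    ENNReal.ofReal (gradOsc u t x) = gradEOsc u t x := by
  rw [gradOsc, gradEOsc, ENNReal.ofReal_mul (by positivity),
    ofReal_integral_eq_lintegral_ofReal (integrableOn_gradOsc hu t x)
      (Filter.Eventually.of_forall fun _ => norm_nonneg _)]
  simp only [ofReal_norm]

theorem measurable_gradEOsc {u : Euc N → ℝ} (hu : ContDiff ℝ 1 u) :
    Measurable fun p : ℝ × Euc N => gradEOsc u p.1 p.2 := by
  have hD : Continuous (fderiv ℝ u) := hu.continuous_fderiv (by simp)
  have h1 : Measurable fun q : (ℝ × Euc N) × Euc N =>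
      {q : (ℝ × Euc N) × Euc N | dist q.2 q.1.2 < q.1.1}.indicator
        (fun q => ‖fderiv ℝ u q.2 - fderiv ℝ u q.1.2‖ₑ) q := by
    refine Measurable.indicator ?_ ?_
    · exact (by fun_prop : Continuous fun q : (ℝ × Euc N) × Euc N =>
        ‖fderiv ℝ u q.2 - fderiv ℝ u q.1.2‖ₑ).measurable
    · exact (isOpen_lt (by fun_prop) (by fun_prop)).measurableSet
  have h2 : Measurable fun p : ℝ × Euc N =>
      ∫⁻ y in ball p.2 p.1, ‖fderiv ℝ u y - fderiv ℝ u p.2‖ₑ := by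
    have h := h1.lintegral_prod_right' (ν := volume)
    have e : (fun p : ℝ × Euc N => ∫⁻ y in ball p.2 p.1, ‖fderiv ℝ u y - fderiv ℝ u p.2‖ₑ) =
        fun p => ∫⁻ y, {q : (ℝ × Euc N) × Euc N | dist q.2 q.1.2 < q.1.1}.indicator
          (fun q => ‖fderiv ℝ u q.2 - fderiv ℝ u q.1.2‖ₑ) (p, y) := by
      funext p
      rw [← lintegral_indicator measurableSet_ball]
      rfl
    rwa [e]
  have h3 : Measurable fun p : ℝ × Euc N => ENNReal.ofReal (p.1 ^ N)⁻¹ :=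
    ((measurable_fst.pow_const N).inv).ennreal_ofReal
  exact h3.mul h2

/-- Jensen's inequality for powers on a ball. -/
theorem gradEOsc_pow_le (hN : 2 ≤ N) {u : Euc N → ℝ} (hu : ContDiff ℝ 1 u) {t : ℝ} (ht : 0 < t)
    (x : Euc N) : gradEOsc u t x ^ N ≤ volume (ball (0 : Euc N) 1) ^ (N - 1) *
      (ENNReal.ofReal (t ^ N)⁻¹ * ∫⁻ y in ball x t, ‖fderiv ℝ u y - fderiv ℝ u x‖ₑ ^ N) := by
  have hD : Continuous (fderiv ℝ u) := hu.continuous_fderiv (by simp)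
  have hN1 : (1 : ℝ) < N := by exact_mod_cast hN
  have hN0 : (N : ℝ) ≠ 0 := by positivity
  have hpq : (N : ℝ).HolderConjugate (N / (N - 1)) := Real.HolderConjugate.conjExponent hN1
  have hm : Measurable fun y => ‖fderiv ℝ u y - fderiv ℝ u x‖ₑ :=
    (by fun_prop : Continuous fun y => ‖fderiv ℝ u y - fderiv ℝ u x‖ₑ).measurable
  have h := ENNReal.lintegral_mul_le_Lp_mul_Lq (volume.restrict (ball x t)) hpq
    hm.aemeasurable (g := fun _ => 1) aemeasurable_const
  simp only [Pi.mul_apply, mul_one, ENNReal.rpow_natCast, ENNReal.one_rpow, lintegral_const,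
    Measure.restrict_apply_univ, one_mul] at h
  set I := ∫⁻ y in ball x t, ‖fderiv ℝ u y - fderiv ℝ u x‖ₑ ^ N with hI
  set v := volume (ball (0 : Euc N) 1) with hv
  have hvol : volume (ball x t) = ENNReal.ofReal (t ^ N) * v := by
    rw [Measure.addHaar_ball_of_pos volume x ht]; simp [hv]
  have htN : 0 < t ^ N := pow_pos ht N
  have h2 : (∫⁻ y in ball x t, ‖fderiv ℝ u y - fderiv ℝ u x‖ₑ) ^ N ≤
      I * volume (ball x t) ^ (N - 1) := by
    calc _ ≤ (I ^ (1 / (N : ℝ)) * volume (ball x t) ^ (1 / ((N : ℝ) / (N - 1)))) ^ N := by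
          gcongr
      _ = I * volume (ball x t) ^ (N - 1) := by
          rw [mul_pow, ← ENNReal.rpow_natCast (_ ^ _), ← ENNReal.rpow_mul,
            ← ENNReal.rpow_natCast (_ ^ _), ← ENNReal.rpow_mul, one_div_mul_cancel hN0,
            ENNReal.rpow_one]
          congr 1
          rw [← ENNReal.rpow_natCast]
          congr 1
          rw [Nat.cast_sub (by omega)]
          field_simp
          simp
  have hcancel : ENNReal.ofReal (t ^ N)⁻¹ * ENNReal.ofReal (t ^ N) = 1 := by
    rw [← ENNReal.ofReal_mul (by positivity), inv_mul_cancel₀ htN.ne', ENNReal.ofReal_one]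
  calc gradEOsc u t x ^ N ≤ ENNReal.ofReal (t ^ N)⁻¹ ^ N * (I * volume (ball x t) ^ (N - 1)) := by
        rw [gradEOsc, mul_pow]; gcongr
    _ = (ENNReal.ofReal (t ^ N)⁻¹ * ENNReal.ofReal (t ^ N)) ^ (N - 1) *
        (v ^ (N - 1) * (ENNReal.ofReal (t ^ N)⁻¹ * I)) := by
        obtain ⟨n, rfl⟩ : ∃ n, N = n + 1 := ⟨N - 1, by omega⟩
        rw [hvol, Nat.add_sub_cancel]
        ring
    _ = _ := by rw [hcancel, one_pow, one_mul]

/-- The weight `t^(1-N)` and the normalization `t^(-N)` of the ball average multiply to `t^(1-2N)`.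
Its integral over the scales that see both `x` and `y`, with `d = |x - y|`, is the Gagliardo kernel.
-/
theorem lintegral_Ioi_weight (hN : 2 ≤ N) {d : ℝ} (hd : 0 < d) :
    ∫⁻ t in Ioi d, ENNReal.ofReal (t * t⁻¹ ^ N) * ENNReal.ofReal (t ^ N)⁻¹ =
      ENNReal.ofReal ((2 * N - 2 : ℝ)⁻¹ * (d ^ (2 * N - 2 : ℝ))⁻¹) := by
  have hN2 : (2 : ℝ) ≤ N := by exact_mod_cast hN
  have ha : (1 - 2 * N : ℝ) < -1 := by linarith
  have h1 : ∫⁻ t in Ioi d, ENNReal.ofReal (t * t⁻¹ ^ N) * ENNReal.ofReal (t ^ N)⁻¹ =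
      ∫⁻ t in Ioi d, ENNReal.ofReal (t ^ (1 - 2 * N : ℝ)) := by
    refine setLIntegral_congr_fun measurableSet_Ioi fun t ht => ?_
    have ht0 : 0 < t := hd.trans ht
    rw [← ENNReal.ofReal_mul (by positivity), Real.rpow_sub ht0, Real.rpow_one, two_mul,
      Real.rpow_add ht0, Real.rpow_natCast, inv_pow]
    congr 1
    field_simp
  rw [h1, ← ofReal_integral_eq_lintegral_ofReal (integrableOn_Ioi_rpow_of_lt ha hd),
    integral_Ioi_rpow_of_lt ha hd]
  · congr 1
    rw [show (1 - 2 * N + 1 : ℝ) = -(2 * N - 2) by ring, Real.rpow_neg hd.le]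
    field_simp
  · refine (ae_restrict_iff' measurableSet_Ioi).2 (Filter.Eventually.of_forall fun t ht => ?_)
    exact Real.rpow_nonneg (hd.trans ht).le _

/-- The scale-invariant measure on the half space for which gradient oscillations are controlled
by the Gagliardo seminorm. -/
noncomputable def scaleMeasure (N : ℕ) : Measure (ℝ × Euc N) :=
  ((volume.restrict (Ioi 0)).withDensity fun t => ENNReal.ofReal (t * t⁻¹ ^ N)).prod volume

theorem measurable_weight (N : ℕ) : Measurable fun t : ℝ => ENNReal.ofReal (t * t⁻¹ ^ N) :=
  (measurable_id.mul (measurable_id.inv.pow_const N)).ennreal_ofReal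

theorem lintegral_scaleMeasure {f : ℝ × Euc N → ℝ≥0∞} (hf : Measurable f) :
    ∫⁻ p, f p ∂scaleMeasure N =
      ∫⁻ t in Ioi 0, ∫⁻ x, ENNReal.ofReal (t * t⁻¹ ^ N) * f (t, x) := by
  rw [scaleMeasure, lintegral_prod _ hf.aemeasurable,
    lintegral_withDensity_eq_lintegral_mul _ (measurable_weight N) hf.lintegral_prod_right']
  refine lintegral_congr fun t => ?_
  exact (lintegral_const_mul _ (hf.comp measurable_prodMk_left)).symm

/-- After Jensen and Tonelli a pair `(x, y)` is counted at the scales `t > |x - y|` only, and the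
scale integral is explicit. -/
theorem lintegral_gradEOsc_pow_le (hN : 2 ≤ N) {u : Euc N → ℝ} (hu : ContDiff ℝ 1 u) :
    ∫⁻ p, gradEOsc u p.1 p.2 ^ N ∂scaleMeasure N ≤
      volume (ball (0 : Euc N) 1) ^ (N - 1) * ENNReal.ofReal (2 * N - 2 : ℝ)⁻¹ *
        ∫⁻ x : Euc N, ∫⁻ y : Euc N, ENNReal.ofReal
          (‖fderiv ℝ u x - fderiv ℝ u y‖ ^ (N : ℝ) / ‖x - y‖ ^ (2 * N - 2 : ℝ)) := by
  have hD : Continuous (fderiv ℝ u) := hu.continuous_fderiv (by simp)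
  have hN2 : (2 : ℝ) ≤ N := by exact_mod_cast hN
  have hm := (measurable_gradEOsc hu).pow_const N
  rw [lintegral_scaleMeasure hm, lintegral_lintegral_swap]
  swap
  · exact (((measurable_weight N).comp measurable_fst).mul hm).aemeasurable
  have hvtop : volume (ball (0 : Euc N) 1) ^ (N - 1) ≠ ∞ :=
    ENNReal.pow_ne_top measure_ball_lt_top.ne
  rw [← lintegral_const_mul' _ _ (ENNReal.mul_ne_top hvtop ENNReal.ofReal_ne_top)]
  refine lintegral_mono fun x => ?_
  set w : ℝ → ℝ≥0∞ := fun t => ENNReal.ofReal (t * t⁻¹ ^ N) * ENNReal.ofReal (t ^ N)⁻¹ with hw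
  have hwm : Measurable w :=
    (measurable_weight N).mul ((measurable_id.pow_const N).inv).ennreal_ofReal
  have hgm : Measurable fun y => ‖fderiv ℝ u y - fderiv ℝ u x‖ₑ ^ N :=
    (by fun_prop : Continuous fun y => ‖fderiv ℝ u y - fderiv ℝ u x‖ₑ).measurable.pow_const N
  have h1 : ∫⁻ t in Ioi 0, ENNReal.ofReal (t * t⁻¹ ^ N) * gradEOsc u t x ^ N ≤
      ∫⁻ t in Ioi 0, volume (ball (0 : Euc N) 1) ^ (N - 1) *
        ∫⁻ y, {q : ℝ × Euc N | dist q.2 x < q.1}.indicator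
          (fun q => ‖fderiv ℝ u q.2 - fderiv ℝ u x‖ₑ ^ N * w q.1) (t, y) := by
    refine setLIntegral_mono_ae' measurableSet_Ioi (Filter.Eventually.of_forall fun t ht => ?_)
    have h2 : ∫⁻ y, {q : ℝ × Euc N | dist q.2 x < q.1}.indicator
          (fun q => ‖fderiv ℝ u q.2 - fderiv ℝ u x‖ₑ ^ N * w q.1) (t, y) =
        (∫⁻ y in ball x t, ‖fderiv ℝ u y - fderiv ℝ u x‖ₑ ^ N) * w t := by
      rw [← lintegral_mul_const _ hgm, ← lintegral_indicator measurableSet_ball]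
      rfl
    rw [h2]
    calc _ ≤ ENNReal.ofReal (t * t⁻¹ ^ N) * (volume (ball (0 : Euc N) 1) ^ (N - 1) *
          (ENNReal.ofReal (t ^ N)⁻¹ * ∫⁻ y in ball x t, ‖fderiv ℝ u y - fderiv ℝ u x‖ₑ ^ N)) := by
          gcongr
          exact gradEOsc_pow_le hN hu ht x
      _ = _ := by rw [hw]; ring
  refine h1.trans ?_
  rw [lintegral_const_mul' _ _ hvtop, mul_assoc]
  gcongr
  rw [lintegral_lintegral_swap, ← lintegral_const_mul' _ _ ENNReal.ofReal_ne_top]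
  swap
  · refine Measurable.aemeasurable (Measurable.indicator ?_ ?_)
    · exact (hgm.comp measurable_snd).mul (hwm.comp measurable_fst)
    · exact (isOpen_lt (by fun_prop) (by fun_prop)).measurableSet
  refine lintegral_mono fun y => ?_
  have h3 : ∫⁻ t in Ioi 0, {q : ℝ × Euc N | dist q.2 x < q.1}.indicator
      (fun q => ‖fderiv ℝ u q.2 - fderiv ℝ u x‖ₑ ^ N * w q.1) (t, y) =
      ‖fderiv ℝ u y - fderiv ℝ u x‖ₑ ^ N * ∫⁻ t in Ioi (dist y x), w t := by
    rw [← lintegral_const_mul _ hwm, ← lintegral_indicator measurableSet_Ioi,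
      ← lintegral_indicator measurableSet_Ioi]
    refine lintegral_congr fun t => ?_
    simp only [indicator, mem_Ioi, mem_ofPred_eq]
    have := dist_nonneg (x := y) (y := x)
    by_cases h : dist y x < t
    · simp [h, this.trans_lt h]
    · simp [h]
  rw [h3]
  -- The explicit scale integral needs a positive distance; on the diagonal the difference of
  -- gradients vanishes instead.
  by_cases hxy : y = x
  · subst hxy
    have h0 : ‖fderiv ℝ u y - fderiv ℝ u y‖ₑ = 0 := by
      rw [← ofReal_norm, sub_self, norm_zero, ENNReal.ofReal_zero]
    rw [h0, zero_pow (by omega), zero_mul]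
    exact zero_le
  · have hd : 0 < dist y x := dist_pos.2 hxy
    rw [hw, lintegral_Ioi_weight hN hd, ← ofReal_norm, ← ENNReal.ofReal_pow (norm_nonneg _),
      ← ENNReal.ofReal_mul (by positivity), ← ENNReal.ofReal_mul (by
        rw [inv_nonneg]; linarith)]
    refine le_of_eq ?_
    congr 1
    rw [dist_comm, dist_eq_norm, Real.rpow_natCast, norm_sub_rev (fderiv ℝ u y)]
    ring

theorem lintegral_gradEOsc_rpow_le (hN : 2 ≤ N) {u : Euc N → ℝ} (hu : ContDiff ℝ 1 u) :
    (∫⁻ p, gradEOsc u p.1 p.2 ^ N ∂scaleMeasure N) ^ (1 / (N : ℝ)) ≤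
      (volume (ball (0 : Euc N) 1) ^ (N - 1) * ENNReal.ofReal (2 * N - 2 : ℝ)⁻¹) ^ (1 / (N : ℝ)) *
        besovENorm (2 - 2 / (N : ℝ)) N u := by
  have hN0 : (N : ℝ) ≠ 0 := by positivity
  have he : (N : ℝ) + (2 - 2 / (N : ℝ) - 1) * N = 2 * N - 2 := by field_simp; ring
  refine (ENNReal.rpow_le_rpow (lintegral_gradEOsc_pow_le hN hu) (by positivity)).trans ?_
  rw [ENNReal.mul_rpow_of_nonneg _ _ (by positivity)]
  gcongr
  rw [besovENorm, gagliardoESeminormDeriv, he]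
  -- Only the Gagliardo part of the norm is used; the `W^{1,N}` part is added for free.
  exact le_add_self

/-- Hölder's inequality for a product of `N` gradient oscillations. -/
theorem lintegral_gradEOsc_mul_pow_le (hN : 2 ≤ N) {w u₁ u₂ : Euc N → ℝ} (hw : ContDiff ℝ 1 w)
    (hu₁ : ContDiff ℝ 1 u₁) (hu₂ : ContDiff ℝ 1 u₂) :
    ∫⁻ p, gradEOsc w p.1 p.2 * (gradEOsc u₁ p.1 p.2 + gradEOsc u₂ p.1 p.2) ^ (N - 1)
      ∂scaleMeasure N ≤
      volume (ball (0 : Euc N) 1) ^ (N - 1) * ENNReal.ofReal (2 * N - 2 : ℝ)⁻¹ *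
      (besovENorm (2 - 2 / (N : ℝ)) N w *
        (besovENorm (2 - 2 / (N : ℝ)) N u₁ + besovENorm (2 - 2 / (N : ℝ)) N u₂) ^ (N - 1)) := by
  have hN1 : (1 : ℝ) < N := by exact_mod_cast hN
  have hN0 : (N : ℝ) ≠ 0 := by positivity
  have hNs : (N : ℝ) - 1 ≠ 0 := by linarith
  have hpq : (N : ℝ).HolderConjugate (N / (N - 1)) := Real.HolderConjugate.conjExponent hN1
  have m1 := measurable_gradEOsc hu₁
  have m2 := measurable_gradEOsc hu₂
  have m3 := measurable_gradEOsc hw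
  set F := fun p : ℝ × Euc N => gradEOsc w p.1 p.2 with hF
  set F₁ := fun p : ℝ × Euc N => gradEOsc u₁ p.1 p.2 with hF₁
  set F₂ := fun p : ℝ × Euc N => gradEOsc u₂ p.1 p.2 with hF₂
  set c := volume (ball (0 : Euc N) 1) ^ (N - 1) * ENNReal.ofReal (2 * N - 2 : ℝ)⁻¹ with hc
  have h := ENNReal.lintegral_mul_le_Lp_mul_Lq (scaleMeasure N) hpq m3.aemeasurable
    (g := fun p => (F₁ p + F₂ p) ^ (N - 1)) ((m1.add m2).pow_const _).aemeasurable
  have hmin := ENNReal.lintegral_Lp_add_le (μ := scaleMeasure N) (p := (N : ℝ)) m1.aemeasurable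
    m2.aemeasurable hN1.le
  simp only [Pi.add_apply, ENNReal.rpow_natCast] at hmin
  have e1 : ∀ p, ((F₁ p + F₂ p) ^ (N - 1)) ^ ((N : ℝ) / (N - 1)) = (F₁ p + F₂ p) ^ N := by
    intro p
    rw [← ENNReal.rpow_natCast, ← ENNReal.rpow_mul, ← ENNReal.rpow_natCast (_ + _) N]
    congr 1
    rw [Nat.cast_sub (by omega)]
    field_simp
    simp
  simp only [e1, ENNReal.rpow_natCast, Pi.mul_apply] at h
  -- The conjugate exponent `N / (N - 1)` turns the second Hölder factor into the `(N - 1)`-th power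
  -- of an `L^N` norm, to which Minkowski applies.
  have e2 : ∀ I : ℝ≥0∞, I ^ (1 / ((N : ℝ) / (N - 1))) = (I ^ (1 / (N : ℝ))) ^ (N - 1) := by
    intro I
    rw [← ENNReal.rpow_natCast (_ ^ _), ← ENNReal.rpow_mul]
    congr 1
    rw [Nat.cast_sub (by omega)]
    field_simp
    simp
  rw [e2] at h
  have b0 := lintegral_gradEOsc_rpow_le hN hw
  have b1 := lintegral_gradEOsc_rpow_le hN hu₁
  have b2 := lintegral_gradEOsc_rpow_le hN hu₂
  refine h.trans ?_
  calc _ ≤ (c ^ (1 / (N : ℝ)) * besovENorm (2 - 2 / (N : ℝ)) N w) *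
        (c ^ (1 / (N : ℝ)) * besovENorm (2 - 2 / (N : ℝ)) N u₁ +
          c ^ (1 / (N : ℝ)) * besovENorm (2 - 2 / (N : ℝ)) N u₂) ^ (N - 1) := by
        gcongr
        exact hmin.trans (add_le_add b1 b2)
    _ = (c ^ (1 / (N : ℝ))) ^ N * (besovENorm (2 - 2 / (N : ℝ)) N w *
        (besovENorm (2 - 2 / (N : ℝ)) N u₁ + besovENorm (2 - 2 / (N : ℝ)) N u₂) ^ (N - 1)) := by
        have hp : ∀ r : ℝ≥0∞, r ^ N = r * r ^ (N - 1) := fun r =>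
          (mul_pow_sub_one (by omega) r).symm
        rw [← mul_add, mul_pow, hp]
        ring
    _ = _ := by
        rw [← ENNReal.rpow_natCast (_ ^ _), ← ENNReal.rpow_mul, one_div_mul_cancel hN0,
          ENNReal.rpow_one]

end IntegralBounds

/-! ### Finiteness of the norms of compactly supported `C²` functions. -/

section Finiteness

open Metric Set

variable {N : ℕ}

/-- In polar coordinates the integrand is `r` near the origin and `r^(1-N)` at infinity. The latter
is integrable only for `N ≥ 3`. -/
theorem integrable_min_pow_div_norm (hN : 3 ≤ N) :
    Integrable fun x : Euc N => min (‖x‖ ^ N) 1 / ‖x‖ ^ (2 * N - 2) := by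
  have : Nontrivial (Euc N) := Module.nontrivial_of_finrank_pos (R := ℝ) (by simp; omega)
  refine (integrable_fun_norm_addHaar (E := Euc N) volume
    (f := fun r => min (r ^ N) 1 / r ^ (2 * N - 2))).2 ?_
  have hdim : Module.finrank ℝ (Euc N) = N := by simp
  rw [hdim, ← Ioc_union_Ioi_eq_Ioi (zero_le_one : (0 : ℝ) ≤ 1)]
  have hsplit : 2 * N - 2 = (N - 1) + (N - 1) := by omega
  refine IntegrableOn.union ?_ ?_
  · have h : IntegrableOn (fun y : ℝ => y) (Ioc 0 1) :=
      (continuous_id.integrableOn_Icc).mono_set Ioc_subset_Icc_self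
    refine h.congr_fun (fun y hy => ?_) measurableSet_Ioc
    have hy0 : 0 < y := hy.1
    have h1 : y ^ N ≤ 1 := pow_le_one₀ hy0.le hy.2
    have h2 : y ^ N = y * y ^ (N - 1) := (mul_pow_sub_one (by omega) y).symm
    simp only [smul_eq_mul]
    rw [min_eq_left h1, hsplit, pow_add, h2]
    field_simp
  · have h : IntegrableOn (fun y : ℝ => y ^ (1 - N : ℝ)) (Ioi 1) := by
      refine integrableOn_Ioi_rpow_of_lt ?_ one_pos
      have : (3 : ℝ) ≤ N := by exact_mod_cast hN
      linarith
    refine h.congr_fun (fun y hy => ?_) measurableSet_Ioi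
    have hy0 : (0 : ℝ) < y := one_pos.trans hy
    have h1 : 1 ≤ y ^ N := one_le_pow₀ (le_of_lt hy)
    simp only [smul_eq_mul]
    have h3 : (1 - N : ℝ) = -((N - 1 : ℕ) : ℝ) := by
      rw [Nat.cast_sub (by omega)]; simp
    rw [min_eq_right h1, hsplit, pow_add, h3, Real.rpow_neg hy0.le, Real.rpow_natCast]
    field_simp

theorem lintegral_gagliardo_lt_top (hN : 3 ≤ N) {u : Euc N → ℝ} (hu : ContDiff ℝ 2 u)
    (hcu : HasCompactSupport u) :
    ∫⁻ x : Euc N, ∫⁻ y : Euc N, ENNReal.ofReal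
      (‖fderiv ℝ u x - fderiv ℝ u y‖ ^ (N : ℝ) / ‖x - y‖ ^ (2 * N - 2 : ℝ)) < ∞ := by
  have hD1 : ContDiff ℝ 1 (fderiv ℝ u) := hu.fderiv_right (by norm_num)
  have hcD : HasCompactSupport (fderiv ℝ u) := hcu.fderiv ℝ
  obtain ⟨L, hL⟩ := hD1.lipschitzWith_of_hasCompactSupport hcD (by simp)
  obtain ⟨M, hM⟩ := hcD.exists_bound_of_continuous hD1.continuous
  have hM0 : 0 ≤ M := (norm_nonneg _).trans (hM 0)
  -- `B` serves both as a Lipschitz constant of `Du`, for nearby points, and as a bound on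
  -- differences of `Du`, for distant ones.
  set B : ℝ := max L (2 * M) with hB
  have hB0 : 0 ≤ B := le_trans (by positivity) (le_max_right _ _)
  set ψ : Euc N → ℝ := fun z => B ^ N * (min (‖z‖ ^ N) 1 / ‖z‖ ^ (2 * N - 2)) with hψ
  have hψi : Integrable ψ := (integrable_min_pow_div_norm hN).const_mul _
  set Ψ : Euc N → ℝ≥0∞ := fun z => ENNReal.ofReal (ψ z) with hΨ
  have hΨm : Measurable Ψ := by
    refine Measurable.ennreal_ofReal (Measurable.const_mul ?_ _)
    exact ((measurable_norm.pow_const N).min measurable_const).div (measurable_norm.pow_const _)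
  have hΨfin : ∫⁻ z, Ψ z < ∞ := hψi.lintegral_lt_top
  set S := tsupport (fderiv ℝ u) with hS
  have hSm : MeasurableSet S := (isClosed_tsupport _).measurableSet
  have hSfin : volume S < ∞ := hcD.measure_lt_top
  have hexp : (2 * N - 2 : ℝ) = ((2 * N - 2 : ℕ) : ℝ) := by
    rw [Nat.cast_sub (by omega)]; simp
  -- The integrand vanishes unless `x` or `y` lies in the support `S`. Each case leaves a
  -- finite-measure variable and an integrable function of `x - y`.
  have hpt : ∀ x y, ENNReal.ofReal
      (‖fderiv ℝ u x - fderiv ℝ u y‖ ^ (N : ℝ) / ‖x - y‖ ^ (2 * N - 2 : ℝ)) ≤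
      S.indicator 1 x * Ψ (x - y) + S.indicator 1 y * Ψ (x - y) := by
    intro x y
    have h1 : ENNReal.ofReal
        (‖fderiv ℝ u x - fderiv ℝ u y‖ ^ (N : ℝ) / ‖x - y‖ ^ (2 * N - 2 : ℝ)) ≤ Ψ (x - y) := by
      refine ENNReal.ofReal_le_ofReal ?_
      simp only [hψ]
      rw [hexp, Real.rpow_natCast, Real.rpow_natCast, ← mul_div_assoc]
      gcongr
      have a1 : ‖fderiv ℝ u x - fderiv ℝ u y‖ ≤ B * ‖x - y‖ := by
        have := hL.dist_le_mul x y
        rw [dist_eq_norm, dist_eq_norm] at this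
        exact this.trans (by gcongr; exact le_max_left _ _)
      have a2 : ‖fderiv ℝ u x - fderiv ℝ u y‖ ≤ B :=
        calc _ ≤ ‖fderiv ℝ u x‖ + ‖fderiv ℝ u y‖ := norm_sub_le _ _
          _ ≤ M + M := add_le_add (hM _) (hM _)
          _ = 2 * M := by ring
          _ ≤ B := le_max_right _ _
      rcases le_total (‖x - y‖ ^ N) 1 with h | h
      · rw [min_eq_left h, ← mul_pow]; gcongr
      · rw [min_eq_right h, mul_one]; gcongr
    by_cases hx : x ∈ S
    · refine h1.trans ?_
      simp [hx]
    · by_cases hy : y ∈ S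
      · refine h1.trans ?_
        simp [hy]
      · have e1 : fderiv ℝ u x = 0 := image_eq_zero_of_notMem_tsupport hx
        have e2 : fderiv ℝ u y = 0 := image_eq_zero_of_notMem_tsupport hy
        have hN0 : (N : ℝ) ≠ 0 := by
          have : N ≠ 0 := by omega
          exact_mod_cast this
        simp [e1, e2, Real.zero_rpow hN0]
  have hi1 : Measurable (S.indicator (1 : Euc N → ℝ≥0∞)) := measurable_one.indicator hSm
  have hm1 : Measurable fun p : Euc N × Euc N => S.indicator 1 p.1 * Ψ (p.1 - p.2) :=
    (hi1.comp measurable_fst).mul (hΨm.comp (measurable_fst.sub measurable_snd))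
  have hm2 : Measurable fun p : Euc N × Euc N => S.indicator 1 p.2 * Ψ (p.1 - p.2) :=
    (hi1.comp measurable_snd).mul (hΨm.comp (measurable_fst.sub measurable_snd))
  have i1 : ∀ x, ∫⁻ y, S.indicator 1 x * Ψ (x - y) = S.indicator 1 x * ∫⁻ z, Ψ z := by
    intro x
    rw [lintegral_const_mul _ (by fun_prop), lintegral_sub_left_eq_self]
  have i2 : ∀ y, ∫⁻ x, S.indicator 1 y * Ψ (x - y) = S.indicator 1 y * ∫⁻ z, Ψ z := by
    intro y
    rw [lintegral_const_mul _ (by fun_prop), lintegral_sub_right_eq_self]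
  have hfin : ∫⁻ x, S.indicator (1 : Euc N → ℝ≥0∞) x * ∫⁻ z, Ψ z < ∞ := by
    rw [lintegral_mul_const _ hi1, lintegral_indicator_one hSm]
    exact ENNReal.mul_lt_top hSfin hΨfin
  calc _ ≤ ∫⁻ x, ∫⁻ y, (S.indicator 1 x * Ψ (x - y) + S.indicator 1 y * Ψ (x - y)) :=
        lintegral_mono fun x => lintegral_mono fun y => hpt x y
    _ = (∫⁻ x, ∫⁻ y, S.indicator 1 x * Ψ (x - y)) +
        ∫⁻ x, ∫⁻ y, S.indicator 1 y * Ψ (x - y) := by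
        rw [← lintegral_add_left hm1.lintegral_prod_right']
        refine lintegral_congr fun x => ?_
        exact lintegral_add_left (hm1.comp measurable_prodMk_left) _
    _ < ∞ := by
        rw [lintegral_lintegral_swap (f := fun x y => S.indicator 1 y * Ψ (x - y))
          hm2.aemeasurable]
        simp only [i1, i2]
        exact ENNReal.add_lt_top.2 ⟨hfin, hfin⟩

/-- Needed because `besovNorm` is a `toReal`, which would send an infinite norm to `0`. -/
theorem besovENorm_ne_top (hN : 3 ≤ N) {u : Euc N → ℝ} (hu : ContDiff ℝ 2 u)
    (hcu : HasCompactSupport u) : besovENorm (2 - 2 / (N : ℝ)) N u ≠ ∞ := by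
  have hN0 : (N : ℝ) ≠ 0 := by positivity
  have he : (N : ℝ) + (2 - 2 / (N : ℝ) - 1) * N = 2 * N - 2 := by field_simp; ring
  have hD1 : ContDiff ℝ 1 (fderiv ℝ u) := hu.fderiv_right (by norm_num)
  refine ENNReal.add_ne_top.2 ⟨ENNReal.add_ne_top.2 ⟨?_, ?_⟩, ?_⟩
  · exact (hu.continuous.memLp_of_hasCompactSupport hcu).2.ne
  · exact (hD1.continuous.memLp_of_hasCompactSupport (hcu.fderiv ℝ)).2.ne
  · rw [gagliardoESeminormDeriv, he]
    exact ENNReal.rpow_ne_top_of_nonneg (by positivity) (lintegral_gagliardo_lt_top hN hu hcu).ne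

theorem ae_norm_le_eLpNorm_top_toReal {α F : Type*} [MeasurableSpace α] [TopologicalSpace α]
    {μ : Measure α} [NormedAddCommGroup F] {f : α → F} (hf : Continuous f)
    (hcf : HasCompactSupport f) : ∀ᵐ x ∂μ, ‖f x‖ ≤ (eLpNorm f ∞ μ).toReal := by
  obtain ⟨M, hM⟩ := hcf.exists_bound_of_continuous hf
  have hfin : eLpNorm f ∞ μ ≠ ∞ := by
    rw [eLpNorm_exponent_top]
    exact (eLpNormEssSup_lt_top_of_ae_bound (Filter.Eventually.of_forall hM)).ne
  have hae : ∀ᵐ x ∂μ, ‖f x‖ₑ ≤ eLpNorm f ∞ μ := by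
    rw [eLpNorm_exponent_top]
    exact ae_le_eLpNormEssSup
  filter_upwards [hae] with x hx
  have h := ENNReal.toReal_mono hfin hx
  rwa [toReal_enorm] at h

theorem ae_norm_fderiv_le_eLpNorm_top_toReal {E F : Type*} [NormedAddCommGroup E]
    [NormedSpace ℝ E] [NormedAddCommGroup F] [NormedSpace ℝ F] [MeasurableSpace E]
    {μ : Measure E} {f : E → F} (hf : ContDiff ℝ 1 f) (hcf : HasCompactSupport f) :
    ∀ᵐ x ∂μ, ‖fderiv ℝ f x‖ ≤ (eLpNorm (fderiv ℝ f) ∞ μ).toReal :=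
  ae_norm_le_eLpNorm_top_toReal (hf.continuous_fderiv (by simp)) (hcf.fderiv ℝ)

theorem abs_hessianMatrix_le_norm (φ : Euc N → ℝ) (x : Euc N) (i j : Fin N) :
    |hessianMatrix φ x i j| ≤ ‖fderiv ℝ (fderiv ℝ φ) x‖ := by
  have h := (fderiv ℝ (fderiv ℝ φ) x).le_opNorm₂ (stdVec i) (stdVec j)
  rwa [norm_stdVec, norm_stdVec, mul_one, mul_one] at h

theorem ae_abs_hessianMatrix_le {φ : Euc N → ℝ} (hφ : ContDiff ℝ 2 φ)
    (hcφ : HasCompactSupport φ) :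
    ∀ᵐ x, ∀ i j, |hessianMatrix φ x i j| ≤ hessianSupNorm φ := by
  have h : ∀ᵐ x, ‖fderiv ℝ (fderiv ℝ φ) x‖ ≤ hessianSupNorm φ :=
    ae_norm_fderiv_le_eLpNorm_top_toReal (hφ.fderiv_right (m := 1) (by norm_num))
      (hcφ.fderiv ℝ)
  filter_upwards [h] with x hx i j
  exact (abs_hessianMatrix_le_norm φ x i j).trans hx

end Finiteness

/-! ### Assembly of the estimate. -/

section Main

open Metric Set

theorem lintegral_mollFlux_sub_le {N : ℕ} (hN : 3 ≤ N) {K : ℝ} (hK0 : 0 ≤ K)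
    (hK : ∀ x, mollifier N x ≤ K ∧ ‖fderiv ℝ (mollifier N) x‖ ≤ K)
    {u₁ u₂ φ : Euc N → ℝ} (hu₁ : ContDiff ℝ 2 u₁)
    (hcu₁ : HasCompactSupport u₁) (hu₂ : ContDiff ℝ 2 u₂) (hcu₂ : HasCompactSupport u₂)
    (hφ : ContDiff ℝ 2 φ) (hcφ : HasCompactSupport φ) :
    ∫⁻ t in Ioi 0, ∫⁻ x, ‖mollFlux u₁ φ t x - mollFlux u₂ φ t x‖ₑ ≤
      ENNReal.ofReal ((N * N * N.factorial * N * K ^ N) * hessianSupNorm φ) *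
      (volume (ball (0 : Euc N) 1) ^ (N - 1) * ENNReal.ofReal (2 * N - 2 : ℝ)⁻¹ *
      (besovENorm (2 - 2 / (N : ℝ)) N (u₁ - u₂) *
        (besovENorm (2 - 2 / (N : ℝ)) N u₁ + besovENorm (2 - 2 / (N : ℝ)) N u₂) ^ (N - 1))) := by
  have h1 : ContDiff ℝ 1 u₁ := hu₁.of_le (by norm_num)
  have h2 : ContDiff ℝ 1 u₂ := hu₂.of_le (by norm_num)
  have h3 : ContDiff ℝ 1 (u₁ - u₂) := h1.sub h2
  have hH0 : 0 ≤ hessianSupNorm φ := ENNReal.toReal_nonneg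
  refine le_trans ?_ (mul_le_mul_right (lintegral_gradEOsc_mul_pow_le (by omega) h3 h1 h2) _)
  have hm : Measurable fun p : ℝ × Euc N => gradEOsc (u₁ - u₂) p.1 p.2 *
      (gradEOsc u₁ p.1 p.2 + gradEOsc u₂ p.1 p.2) ^ (N - 1) :=
    (measurable_gradEOsc h3).mul
      (((measurable_gradEOsc h1).add (measurable_gradEOsc h2)).pow_const _)
  rw [lintegral_scaleMeasure hm, ← lintegral_const_mul' _ _ ENNReal.ofReal_ne_top]
  refine setLIntegral_mono_ae' measurableSet_Ioi (Filter.Eventually.of_forall fun t ht => ?_)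
  replace ht : 0 < t := ht
  rw [← lintegral_const_mul' _ _ ENNReal.ofReal_ne_top]
  refine lintegral_mono_ae ?_
  filter_upwards [ae_abs_hessianMatrix_le hφ hcφ] with x hx
  have o1 := gradOsc_nonneg u₁ ht x
  have o2 := gradOsc_nonneg u₂ ht x
  have o3 := gradOsc_nonneg (u₁ - u₂) ht x
  rw [← ofReal_gradOsc h1 ht, ← ofReal_gradOsc h2 ht, ← ofReal_gradOsc h3 ht,
    ← ENNReal.ofReal_add o1 o2, ← ENNReal.ofReal_pow (by positivity), ← ENNReal.ofReal_mul o3,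
    ← ENNReal.ofReal_mul (by positivity), ← ENNReal.ofReal_mul (by positivity), ← ofReal_norm]
  exact ENNReal.ofReal_le_ofReal
    (abs_mollFlux_sub_le (by omega) hK0 hK hu₁ hcu₁ hu₂ hcu₂ ht hx)

/-- The tested difference of Hessian determinants is the total flux over all scales. -/
theorem enorm_integral_det_sub_mul_le {N : ℕ} (hN : 1 ≤ N) {u₁ u₂ φ : Euc N → ℝ}
    (hu₁ : ContDiff ℝ 2 u₁)
    (hcu₁ : HasCompactSupport u₁) (hu₂ : ContDiff ℝ 2 u₂) (hcu₂ : HasCompactSupport u₂)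
    (hφ : ContDiff ℝ 2 φ) (hcφ : HasCompactSupport φ) :
    ‖∫ x, ((hessianMatrix u₁ x).det - (hessianMatrix u₂ x).det) * φ x‖ₑ ≤
      ∫⁻ t in Ioi 0, ∫⁻ x, ‖mollFlux u₁ φ t x - mollFlux u₂ φ t x‖ₑ := by
  set R := ∫⁻ t in Ioi 0, ∫⁻ x, ‖mollFlux u₁ φ t x - mollFlux u₂ φ t x‖ₑ with hR
  have hint : ∀ {u : Euc N → ℝ}, ContDiff ℝ 2 u →
      Integrable fun x => (hessianMatrix u x).det * φ x := fun hu =>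
    ((Continuous.matrix_det (continuous_matrix fun i j => continuous_hessianMatrix hu i j)).mul
      hφ.continuous).integrable_of_hasCompactSupport hcφ.mul_left
  simp only [sub_mul]
  rw [integral_sub (hint hu₁) (hint hu₂)]
  set X := (∫ x, (hessianMatrix u₁ x).det * φ x) - ∫ x, (hessianMatrix u₂ x).det * φ x with hX
  set D : ℝ → ℝ := fun t => (∫ x, (hessianMatrix (moll u₁ t) x).det * φ x) -
    ∫ x, (hessianMatrix (moll u₂ t) x).det * φ x with hD
  have l0 : Filter.Tendsto D (nhdsWithin 0 (Ioi 0)) (nhds X) :=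
    (tendsto_integral_det_moll_zero hu₁ hcu₁ hφ.continuous hcφ).sub
      (tendsto_integral_det_moll_zero hu₂ hcu₂ hφ.continuous hcφ)
  have l1 : Filter.Tendsto D Filter.atTop (nhds 0) := by
    simpa using (tendsto_integral_det_moll_atTop hN hu₁ hcu₁ hφ.continuous hcφ).sub
      (tendsto_integral_det_moll_atTop hN hu₂ hcu₂ hφ.continuous hcφ)
  -- The bound between scales `a` and `b` is uniform in both, so `a → 0` is taken first at fixed
  -- `b`, and then `b → ∞`.
  have hb : ∀ b, 0 < b → ‖D b - X‖ₑ ≤ R := by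
    intro b hb
    refine le_of_tendsto ((tendsto_const_nhds.sub l0).enorm) ?_
    filter_upwards [Ioc_mem_nhdsGT hb] with a ha
    exact enorm_integral_det_sub_le hu₁ hcu₁ hu₂ hcu₂ hφ hcφ ha.1 ha.2
  have hlim : ‖0 - X‖ₑ ≤ R := by
    refine le_of_tendsto ((l1.sub tendsto_const_nhds).enorm) ?_
    filter_upwards [Filter.eventually_gt_atTop 0] with b h
    exact hb b h
  simpa using hlim

end Main

theorem theorem1 (N : ℕ) (hN : 3 ≤ N) :
    ∃ C : ℝ, 0 < C ∧
      ∀ u₁ u₂ φ : EuclideanSpace ℝ (Fin N) → ℝ,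
        ContDiff ℝ 2 u₁ → HasCompactSupport u₁ →
        ContDiff ℝ 2 u₂ → HasCompactSupport u₂ →
        ContDiff ℝ 2 φ → HasCompactSupport φ →
        |∫ x, ((hessianMatrix u₁ x).det - (hessianMatrix u₂ x).det) * φ x| ≤
          C * besovNorm (2 - 2 / (N : ℝ)) N (u₁ - u₂) *
            (besovNorm (2 - 2 / (N : ℝ)) N u₁ ^ (N - 1) +
              besovNorm (2 - 2 / (N : ℝ)) N u₂ ^ (N - 1)) *
            hessianSupNorm φ := by
  obtain ⟨K, hK0, hK⟩ := exists_mollifier_bound N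
  set c : ℝ≥0∞ := volume (Metric.ball (0 : Euc N) 1) ^ (N - 1) *
    ENNReal.ofReal (2 * N - 2 : ℝ)⁻¹ with hc
  have hctop : c ≠ ∞ := ENNReal.mul_ne_top (ENNReal.pow_ne_top measure_ball_lt_top.ne)
    ENNReal.ofReal_ne_top
  have hN3 : (3 : ℝ) ≤ N := by exact_mod_cast hN
  have hc0 : 0 < c.toReal := by
    refine ENNReal.toReal_pos (mul_ne_zero (pow_ne_zero _ ?_) ?_) hctop
    · exact (Metric.measure_ball_pos volume _ one_pos).ne'
    · exact (ENNReal.ofReal_pos.2 (inv_pos.2 (by linarith))).ne'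
  set A : ℝ := N * N * N.factorial * N * K ^ N with hA
  have hA0 : 0 < A := by
    have : (0 : ℝ) < N := by linarith
    have : (0 : ℝ) < N.factorial := by exact_mod_cast N.factorial_pos
    positivity
  -- The power of two comes from `(p + q)^(N-1) ≤ 2^(N-2) (p^(N-1) + q^(N-1))`.
  refine ⟨A * c.toReal * 2 ^ (N - 1 - 1), by positivity, ?_⟩
  intro u₁ u₂ φ hu₁ hcu₁ hu₂ hcu₂ hφ hcφ
  have hw : ContDiff ℝ 2 (u₁ - u₂) := hu₁.sub hu₂
  have t1 := besovENorm_ne_top hN hu₁ hcu₁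
  have t2 := besovENorm_ne_top hN hu₂ hcu₂
  have t3 := besovENorm_ne_top hN hw (hcu₁.sub hcu₂)
  have hH0 : 0 ≤ hessianSupNorm φ := ENNReal.toReal_nonneg
  have h := (enorm_integral_det_sub_mul_le (by omega) hu₁ hcu₁ hu₂ hcu₂ hφ hcφ).trans
    (lintegral_mollFlux_sub_le hN hK0.le hK hu₁ hcu₁ hu₂ hcu₂ hφ hcφ)
  -- Passing to real numbers requires a finite right-hand side, hence the finiteness of all three
  -- norms.
  have h' := ENNReal.toReal_mono (ENNReal.mul_ne_top ENNReal.ofReal_ne_top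
    (ENNReal.mul_ne_top hctop (ENNReal.mul_ne_top t3
      (ENNReal.pow_ne_top (ENNReal.add_ne_top.2 ⟨t1, t2⟩))))) h
  simp only [toReal_enorm, Real.norm_eq_abs, ENNReal.toReal_mul, ENNReal.toReal_pow] at h'
  rw [ENNReal.toReal_add t1 t2, ENNReal.toReal_ofReal (by positivity)] at h'
  refine h'.trans ?_
  change A * hessianSupNorm φ * (c.toReal * (besovNorm (2 - 2 / (N : ℝ)) N (u₁ - u₂) *
    (besovNorm (2 - 2 / (N : ℝ)) N u₁ + besovNorm (2 - 2 / (N : ℝ)) N u₂) ^ (N - 1))) ≤ _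
  have b1 : 0 ≤ besovNorm (2 - 2 / (N : ℝ)) N u₁ := ENNReal.toReal_nonneg
  have b2 : 0 ≤ besovNorm (2 - 2 / (N : ℝ)) N u₂ := ENNReal.toReal_nonneg
  have b3 : 0 ≤ besovNorm (2 - 2 / (N : ℝ)) N (u₁ - u₂) := ENNReal.toReal_nonneg
  have hp := add_pow_le b1 b2 (N - 1)
  calc _ ≤ A * hessianSupNorm φ * (c.toReal * (besovNorm (2 - 2 / (N : ℝ)) N (u₁ - u₂) *
        (2 ^ (N - 1 - 1) * (besovNorm (2 - 2 / (N : ℝ)) N u₁ ^ (N - 1) +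
          besovNorm (2 - 2 / (N : ℝ)) N u₂ ^ (N - 1))))) := by gcongr
    _ = _ := by ring
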